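/- **Setting.** Let $X\subset\mathbb{N}$ have at least two elements, $\hat\Sigma=X^{\mathbb{Z}}$ with the distance $\sum_{k\in\mathbb Z}2^{-|k|}[x_k\neq y_k]$ and the shift $\hat\sigma$; write $\Sigma^-=X^{\mathbb{Z}_{<0}}$, $\Sigma=X^{\mathbb{Z}_{\ge 0}}$, $\hat\Sigma=\Sigma^-\times\Sigma$, and $P:\hat\Sigma\to\Sigma$ for the projection. Let $K$ be a compact (connected) Riemannian manifold, $\hat M=\hat\Sigma\times K$, $M=\Sigma\times K$. Let $\hat f(\hat x,t)=(\hat\sigma(\hat x),\hat f_{\hat x}(t))$ be a homeomorphism of $\hat M$ such that the $\hat f_{\hat x}$ are $C^1$ diffeomorphisms of $K$ with $\tfrac12\|D\hat f_{\hat x}(t)\|<1$ and $\tfrac12\|D\hat f_{\hat x}^{-1}(t)\|<1$ everywhere, $\hat x\mapsto\hat f_{\hat x}$ is Hölder continuous in the $C^1$ distance, and $\sup_{\hat x\in\hat\Sigma,\,n\in\mathbb{Z}}\|D\hat f^n_{\hat x}\|<\infty$ (mostly neutral center direction). If $\hat x,\hat y$ have the same entries in all positions $k\le 0$, let $h^u_{\hat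 x,\hat y}=\lim_{n\to-\infty}(\hat f^n_{\hat y})^{-1}\circ\hat f^n_{\hat x}$, and let $W^{uu}_{loc}(\hat x,t)$ be the set of all the points $(\hat y,h^u_{\hat x,\hat y}(t))$. Let $\hat\mu=\hat\rho\,(\mu^s\times\mu^u\times\mu^c)$ be an $\hat f$-invariant probability measure on $\hat M$, where $\mu^s,\mu^u,\mu^c$ are probability measures on $\Sigma^-,\Sigma,K$, the supports of $\mu^s$ and $\mu^u$ are all of $\Sigma^-$ and $\Sigma$, and $\hat\rho$ is continuous and bounded from zero and infinity. Put $\rho(x,t)=\int\hat\rho(x^s,x,t)\,d\mu^s(x^s)$. Let $1\le l<d$ and let $\hat A:\hat M\to GL(d,\mathbb{C})$ be $\alpha$-Hölder continuous, $\alpha>0$, and admit strong-unstable holonomies: linear isomorphisms $H^u_{\hat p,\hat q}$ of $\mathbb{C}^d$, for $\hat q\in W^{uu}_{loc}(\hat p)$, with $H^u_{\hat f^{-1}(\hat p),\hat f^{-1}(\hat q)}=\hat A(\hat f^{-1}(\hat q))^{-1}H^u_{\hat p,\hat q}\hat A(\hat f^{-1}(\hat p))$, $H^u_{\hat p,\hat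 p}=\mathrm{id}$, $H^u_{\hat p,\hat q}=H^u_{\hat z,\hat q}H^u_{\hat p,\hat z}$ for $\hat z \in W^{uu}_{loc}(\hat p)$, and $\|H^u_{\hat p,\hat q}-\mathrm{id}\|\le L\,\mathrm{dist}(\hat p,\hat q)^\alpha$ for some constant $L>0$. Assume that $\hat f_{\hat x}=f_x$ and $\hat A(\hat x,t)$ depend on $\hat x$ only through $x=P(\hat x)$, and write $f^j_x=f_{\sigma^{j-1}(x)}\circ\cdots\circ f_x$ for $j\ge 0$, where $\sigma$ is the one-sided shift. Let $\hat m$ be a $u$-state on $\hat M\times\mathrm{Grass}(l,d)$ that projects to $\hat\mu$ and is invariant under $\hat F(\hat q,V)=(\hat f(\hat q),\hat A(\hat q)V)$: it has a disintegration $\{\hat m_{\hat q}\}$ along the fibers $\{\hat q\}\times\mathrm{Grass}(l,d)$ and there is a set $\tilde M\subset\hat M$ of full $\hat\mu$-measure with $\hat m_{\hat q}=(H^u_{\hat b,\hat q})_*\hat m_{\hat b}$ for all $\hat b,\hat q\in\tilde M$ with $\hat q\in W^{uu}_{loc}(\hat b)$. Let $\mu$ and $m$ be the projections of $\hat\mu$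 and $\hat m$ to $M$ and $M\times\mathrm{Grass}(l,d)$. **Proposition.** There is a disintegration $\{m_{x,t}:(x,t)\in M\}$ of $m$ along the fibers $\{(x,t)\}\times\mathrm{Grass}(l,d)$ (a measurable family of probability measures, defined for every $(x,t)$) such that: 1. $m_{x,t}=\frac{1}{\rho(x,t)}\int\hat\rho(x^s,x,t)\,\hat m_{x^s,x,t}\,d\mu^s(x^s)$ for $\mu^c$-almost every $t$, for every $x\in\Sigma$ such that $(x^s,x,t)\in\tilde M$ for $\mu^s\times\mu^c$-almost every $(x^s,t)$. 2. For every continuous $\varphi:\mathrm{Grass}(l,d)\to\mathbb{R}$, every sequence $x_n\to x$ in $\Sigma$ and all integers $j_n\ge0$ such that $(f^{j_n}_{x_n})_n$ converges uniformly to some $g:K\to K$, the functions $t\mapsto\int\varphi\,dm_{x_n,f^{j_n}_{x_n}(t)}$ and $t\mapsto\int\varphi\,dm_{x,g(t)}$ are in $L^1(\mu^c)$, and the former converge to the latter in $L^1(\mu^c)$. 3. Consequently, for every sequence $x_n\to x$ in $\Sigma$ there is a subsequence $(x_{n_k})_k$ with $m_{x_{n_k},t}\to m_{x,t}$ in the weak$^*$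 topology for $\mu^c$-almost every $t\in K$. -/

import Mathlib

open MeasureTheory ProbabilityTheory Filter Topology Bundle
open scoped Manifold ContDiff

noncomputable section

namespace UStates

/-! ### Shift spaces

`ℤ → X` is the two-sided full shift on the alphabet `X ⊆ ℕ` (product of discrete spaces).
The space of futures `(x_k)_{k ≥ 0}` is `ℕ → X`; the space of pasts `(x_k)_{k < 0}` is also coded
by `ℕ → X`, its `n`-th entry being the symbol at position `-(n+1)`. -/

/-- The `n`-th power of the two-sided shift, `n ∈ ℤ`. -/
def shiftBy {X : Set ℕ} (n : ℤ) (x : ℤ → X) : ℤ → X := fun k => x (k + n)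

/-- The projection from the two-sided shift space to the space of futures. -/
def future {X : Set ℕ} (x : ℤ → X) : ℕ → X := fun k => x (k : ℤ)

/-- The two-sided sequence with past `xs` and future `xu`. -/
def glue {X : Set ℕ} (xs xu : ℕ → X) : ℤ → X
  | Int.ofNat k => xu k
  | Int.negSucc k => xs k

open Classical in
/-- The distance `∑_{k ∈ ℤ} 2^{-|k|} [x_k ≠ y_k]` on the two-sided shift space. -/
def shiftDist {X : Set ℕ} (x y : ℤ → X) : ℝ :=
  ∑' k : ℤ, if x k = y k then 0 else (1 / 2 : ℝ) ^ k.natAbs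

/-- The distance on `(ℤ → X) × K`. -/
def totalDist {X : Set ℕ} {K : Type*} [MetricSpace K] (p q : (ℤ → X) × K) : ℝ :=
  shiftDist p.1 q.1 + dist p.2 q.2

/-! ### Partially hyperbolic skew-products -/

section SkewProducts

variable (X : Set ℕ) (n : ℕ) (K : Type*) [MetricSpace K]
  [ChartedSpace (EuclideanSpace ℝ (Fin n)) K] [IsManifold (𝓡 n) ∞ K]
  [RiemannianBundle (fun t : K => TangentSpace (𝓡 n) t)]

/-- A partially hyperbolic skew-product `(x, t) ↦ (σ x, f_x t)` over the two-sided shift, with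
fibre the Riemannian manifold `K` and fibre maps `f_x` that are (`C^1`) diffeomorphisms. -/
structure SkewProduct where
  /-- the fibre maps -/
  fib : (ℤ → X) → (K ≃ₘ^1⟮𝓡 n, 𝓡 n⟯ K)
  isHomeomorph :
    IsHomeomorph (fun p : (ℤ → X) × K => ((shiftBy 1 p.1, fib p.1 p.2) : (ℤ → X) × K))
  /-- domination of the fibre maps by the base dynamics, whose contraction rate is `1 / 2` -/
  dominated : ∀ (x : ℤ → X) (t : K),
    (1 / 2 : ℝ) * ‖mfderiv (𝓡 n) (𝓡 n) (fib x) t‖ < 1 ∧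
    (1 / 2 : ℝ) * ‖mfderiv (𝓡 n) (𝓡 n) (fib x).symm t‖ < 1
  /-- Hölder dependence of `f_x` on `x` in the `C^1` distance. The `C^0` part is measured by the
  distance of `K`, the part on first derivatives by testing against smooth functions on `K`
  (equivalently, against the coordinates of a smooth embedding of `K` in a Euclidean space). -/
  holder : ∃ α : ℝ, 0 < α ∧
    (∃ C : ℝ, ∀ (x y : ℤ → X) (t : K), dist (fib x t) (fib y t) ≤ C * shiftDist x y ^ α) ∧
    ∀ φ : K → ℝ, ContMDiff (𝓡 n) 𝓘(ℝ, ℝ) ∞ φ →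
      ∃ C : ℝ, ∀ (x y : ℤ → X) (t : K) (v : TangentSpace (𝓡 n) t),
        let w : ℝ := mfderiv (𝓡 n) 𝓘(ℝ, ℝ) (fun s : K => φ (fib x s) - φ (fib y s)) t v
        |w| ≤ C * shiftDist x y ^ α * ‖v‖

variable {X n K}

namespace SkewProduct

/-- The map `(x, t) ↦ (σ x, f_x t)`. -/
def map (F : SkewProduct X n K) (p : (ℤ → X) × K) : (ℤ → X) × K :=
  (shiftBy 1 p.1, F.fib p.1 p.2)

/-- `f_{σ^{m-1} x} ∘ ⋯ ∘ f_x`. -/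
def fwd (F : SkewProduct X n K) (x : ℤ → X) : ℕ → (K ≃ₘ^1⟮𝓡 n, 𝓡 n⟯ K)
  | 0 => Diffeomorph.refl (𝓡 n) K 1
  | m + 1 => (fwd F x m).trans (F.fib (shiftBy m x))

/-- The fibre iterates `f^m_x`, `m ∈ ℤ`; for `m < 0` this is
`f_{σ^m x}⁻¹ ∘ ⋯ ∘ f_{σ^{-1} x}⁻¹ = (f^{-m}_{σ^m x})⁻¹`. -/
def iter (F : SkewProduct X n K) (x : ℤ → X) : ℤ → (K ≃ₘ^1⟮𝓡 n, 𝓡 n⟯ K)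
  | Int.ofNat m => F.fwd x m
  | Int.negSucc m => (F.fwd (shiftBy (Int.negSucc m) x) (m + 1)).symm

/-- Mostly neutral center direction: all fibre iterates have uniformly bounded derivatives. -/
def MostlyNeutral (F : SkewProduct X n K) : Prop :=
  ∃ C : ℝ, ∀ (x : ℤ → X) (m : ℤ) (t : K), ‖mfderiv (𝓡 n) (𝓡 n) (F.iter x m) t‖ ≤ C

/-- `F.Wuu p q` says that `q` belongs to the local strong-unstable set of `p`: with `p = (x, t)`
and `q = (y, s)`, the sequences `x` and `y` have the same entries in all positions `k ≤ 0`, and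
`s = h^u_{x,y}(t) = lim_{m → -∞} (f^m_y)⁻¹ (f^m_x t)`. -/
def Wuu (F : SkewProduct X n K) (p q : (ℤ → X) × K) : Prop :=
  (∀ k : ℤ, k ≤ 0 → q.1 k = p.1 k) ∧
  Tendsto (fun m : ℕ => (F.iter q.1 (-(m : ℤ))).symm (F.iter p.1 (-(m : ℤ)) p.2)) atTop (𝓝 q.2)

end SkewProduct

end SkewProducts

/-- The fibre iterates `f^j_x = f_{σ^{j-1} x} ∘ ⋯ ∘ f_x`, `j ≥ 0`, of a skew-product over the
one-sided shift. -/
def oneSidedIter {X : Set ℕ} {K : Type*} (f : (ℕ → X) → K → K) (x : ℕ → X) : ℕ → K → K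
  | 0 => id
  | j + 1 => f (fun k => x (k + j)) ∘ oneSidedIter f x j

/-! ### Measures with partial product structure -/

/-- The data of a probability measure `ρ · (μs × μu × μc)` with partial product structure. -/
structure PartialProduct (X : Set ℕ) (K : Type*) [TopologicalSpace K] [MeasurableSpace K] where
  /-- probability on pasts -/
  μs : Measure (ℕ → X)
  /-- probability on futures -/
  μu : Measure (ℕ → X)
  /-- probability on the fibre -/
  μc : Measure K
  isProb_s : IsProbabilityMeasure μs
  isProb_u : IsProbabilityMeasure μu
  isProb_c : IsProbabilityMeasure μc
  /-- the support of `μs` is the whole space -/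
  openPos_s : μs.IsOpenPosMeasure
  /-- the support of `μu` is the whole space -/
  openPos_u : μu.IsOpenPosMeasure
  /-- the density -/
  ρ : (ℤ → X) × K → ℝ
  continuous_ρ : Continuous ρ
  bounded_ρ : ∃ a b : ℝ, 0 < a ∧ ∀ p, a ≤ ρ p ∧ ρ p ≤ b
  isProb : IsProbabilityMeasure
    ((((μs.prod μu).prod μc).map
      (fun p : ((ℕ → X) × (ℕ → X)) × K => ((glue p.1.1 p.1.2, p.2) : (ℤ → X) × K))).withDensity
        (fun p => ENNReal.ofReal (ρ p)))

namespace PartialProduct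

variable {X : Set ℕ} {K : Type*} [TopologicalSpace K] [MeasurableSpace K]

/-- The measure `ρ · (μs × μu × μc)` on `(ℤ → X) × K`. -/
def measure (μ : PartialProduct X K) : Measure ((ℤ → X) × K) :=
  (((μ.μs.prod μ.μu).prod μ.μc).map
    (fun p : ((ℕ → X) × (ℕ → X)) × K => ((glue p.1.1 p.1.2, p.2) : (ℤ → X) × K))).withDensity
      (fun p => ENNReal.ofReal (μ.ρ p))

instance (μ : PartialProduct X K) : IsProbabilityMeasure μ.measure := μ.isProb

/-- The density `(x, t) ↦ ∫ ρ(xs, x, t) dμs(xs)` of the projection to `(ℕ → X) × K`. -/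
def ρu (μ : PartialProduct X K) (x : ℕ → X) (t : K) : ℝ :=
  ∫ xs, μ.ρ (glue xs x, t) ∂μ.μs

end PartialProduct

/-! ### Grassmannians -/

/-- The Grassmannian of `l`-dimensional subspaces of `ℂ^d`. -/
def Grass (l d : ℕ) : Type :=
  {V : Submodule ℂ (EuclideanSpace ℂ (Fin d)) // Module.finrank ℂ V = l}

/-- The usual topology of the Grassmannian: `V` depends on its orthogonal projection. -/
instance (l d : ℕ) : TopologicalSpace (Grass l d) :=
  TopologicalSpace.induced
    (fun V : Grass l d =>
      (V.1.starProjection : EuclideanSpace ℂ (Fin d) →L[ℂ] EuclideanSpace ℂ (Fin d)))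
    inferInstance

instance (l d : ℕ) : MeasurableSpace (Grass l d) := borel _

instance (l d : ℕ) : BorelSpace (Grass l d) := ⟨rfl⟩

/-- The action of an invertible linear map on the Grassmannian. -/
def Grass.map {l d : ℕ} (B : EuclideanSpace ℂ (Fin d) ≃L[ℂ] EuclideanSpace ℂ (Fin d))
    (V : Grass l d) : Grass l d :=
  ⟨V.1.map (B.toLinearEquiv : EuclideanSpace ℂ (Fin d) →ₗ[ℂ] EuclideanSpace ℂ (Fin d)),
    (LinearEquiv.finrank_map_eq B.toLinearEquiv V.1).trans V.2⟩

/-! ### Linear cocycles, holonomies, `u`-states -/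

section Cocycles

variable {X : Set ℕ} {n : ℕ} {K : Type*} [MetricSpace K]
  [ChartedSpace (EuclideanSpace ℝ (Fin n)) K] [IsManifold (𝓡 n) ∞ K]
  [RiemannianBundle (fun t : K => TangentSpace (𝓡 n) t)] {d : ℕ}

/-- `α`-Hölder continuity of a map with values in `GL(d, ℂ)`. -/
def IsHolderCocycle (α : ℝ)
    (A : (ℤ → X) × K → (EuclideanSpace ℂ (Fin d) ≃L[ℂ] EuclideanSpace ℂ (Fin d))) : Prop :=
  ∃ C : ℝ, ∀ p q : (ℤ → X) × K,
    ‖(A p : EuclideanSpace ℂ (Fin d) →L[ℂ] EuclideanSpace ℂ (Fin d)) - A q‖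
      ≤ C * totalDist p q ^ α

/-- `H` is a family of strong-unstable holonomies of the cocycle `A` over `F`. Only the values
`H p q` with `q` in the local strong-unstable set of `p` are relevant. -/
structure IsUnstableHolonomy (F : SkewProduct X n K) (α : ℝ)
    (A : (ℤ → X) × K → (EuclideanSpace ℂ (Fin d) ≃L[ℂ] EuclideanSpace ℂ (Fin d)))
    (H : (ℤ → X) × K → (ℤ → X) × K →
      (EuclideanSpace ℂ (Fin d) ≃L[ℂ] EuclideanSpace ℂ (Fin d))) : Prop where
  /-- `H_{f⁻¹ p, f⁻¹ q} = A(f⁻¹ q)⁻¹ ∘ H_{p,q} ∘ A(f⁻¹ p)`, written with `f p`, `f q` for `p`, `q`;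
  the relation for higher backward iterates follows by iteration. -/
  equivariant : ∀ p q : (ℤ → X) × K, F.Wuu (F.map p) (F.map q) →
    ∀ v, H (F.map p) (F.map q) (A p v) = A q (H p q v)
  refl : ∀ p v, H p p v = v
  comp : ∀ p q z : (ℤ → X) × K, F.Wuu p q → F.Wuu p z → ∀ v, H p q v = H z q (H p z v)
  holder : ∃ L : ℝ, 0 < L ∧ ∀ p q : (ℤ → X) × K, F.Wuu p q →
    ‖(H p q : EuclideanSpace ℂ (Fin d) →L[ℂ] EuclideanSpace ℂ (Fin d)) -
        ContinuousLinearMap.id ℂ (EuclideanSpace ℂ (Fin d))‖ ≤ L * totalDist p q ^ α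

/-- The skew-product `(p, V) ↦ (f p, A(p) V)` induced on the Grassmannian bundle. -/
def grassMap {l : ℕ} (F : SkewProduct X n K)
    (A : (ℤ → X) × K → (EuclideanSpace ℂ (Fin d) ≃L[ℂ] EuclideanSpace ℂ (Fin d)))
    (z : ((ℤ → X) × K) × Grass l d) : ((ℤ → X) × K) × Grass l d :=
  (F.map z.1, Grass.map (A z.1) z.2)

/-- The probability measure `mhat` on the Grassmannian bundle is a `u`-state projecting to `μ`, and
this is exhibited by the disintegration `κ`, which is invariant under the unstable holonomies `H`
on the set `S` of full `μ`-measure. -/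
structure IsUState [MeasurableSpace K] {l : ℕ} (F : SkewProduct X n K)
    (H : (ℤ → X) × K → (ℤ → X) × K →
      (EuclideanSpace ℂ (Fin d) ≃L[ℂ] EuclideanSpace ℂ (Fin d)))
    (μ : Measure ((ℤ → X) × K)) (mhat : Measure (((ℤ → X) × K) × Grass l d))
    (κ : Kernel ((ℤ → X) × K) (Grass l d)) (S : Set ((ℤ → X) × K)) : Prop where
  markov : IsMarkovKernel κ
  disintegration : μ ⊗ₘ κ = mhat
  full : μ Sᶜ = 0
  invariant : ∀ b ∈ S, ∀ q ∈ S, F.Wuu b q → κ q = (κ b).map (Grass.map (H b q))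

end Cocycles

end UStates

end

/-! ### Lipschitz bounds and tests by continuous functions -/

namespace UStates

open scoped NNReal ENNReal

/-! The formula in item 1 already disintegrates the projected measure; the difficulty is that it is
only controlled over the set D = `fullFutures` of futures above which S has full measure. D has full
`μu`-measure, hence is dense. The plan is to show that the averages vary little in L¹ along D, to
extend them to all futures by weak* continuity, and then to recover L¹ continuity.

Variation along D. Let x, y in D share their first N symbols and fix a past. Neutrality and Hölder
dependence make the holonomy h between the two fibres uniformly close to the identity, so
`Grass.map` of the linear holonomy is close to the identity too, and the u-state property makes the
conditional measures at t and h(t) close (`exists_abs_fibreIntegral_hol_sub_le`). This compares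
integrals at displaced points. To remove the displacement, the integral over y is approximated in L¹
by a continuous function g. The holonomies have Jacobians bounded by a uniform constant, because the
invariant measure has a density bounded from zero and infinity (`exists_map_fwd_le`,
`exists_map_hol_le`); so the approximation survives composition with h, and g ∘ h depends
continuously on x (`exists_integral_abs_fibreIntegral_sub_le`). Averaging over the pasts gives
`exists_integral_abs_avg_sub_le`: near any x₀, all futures in D have averages L¹-close to one
function, which need not be identified.

Extension. For x in D put the averages together into a probability on K × Grass with marginal `μc`.
Compactness and the previous estimate give a weak* continuous extension to all x; its conditional
measures along K define m (`exists_continuous_modification`). L¹ norms are suprema over continuous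
test functions, so the estimate along D passes to weak* limits and yields L¹ continuity everywhere.

Item 2 then follows from the Jacobian bounds for the iterates (`tendsto_integral_abs_comp_sub`), and
item 3 from a diagonal extraction over a dense sequence of test functions
(`exists_subseq_ae_tendsto`). -/

theorem lipschitzWith_of_norm_mfderiv_le {n : ℕ} {K : Type*} [MetricSpace K]
    [ChartedSpace (EuclideanSpace ℝ (Fin n)) K] [IsManifold (𝓡 n) ∞ K]
    [RiemannianBundle (fun t : K => TangentSpace (𝓡 n) t)]
    [IsRiemannianManifold (𝓡 n) K] {φ : K → K} (hφ : ContMDiff (𝓡 n) (𝓡 n) 1 φ) {C : ℝ≥0}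
    (hC : ∀ t, ‖mfderiv (𝓡 n) (𝓡 n) φ t‖ ≤ C) : LipschitzWith C φ := by
  intro x y
  rw [IsRiemannianManifold.out (I := 𝓡 n) (φ x) (φ y), IsRiemannianManifold.out (I := 𝓡 n) x y]
  rcases eq_or_ne (Manifold.riemannianEDist (𝓡 n) x y) ⊤ with htop | htop
  · rw [← IsRiemannianManifold.out (I := 𝓡 n) x y] at htop
    exact absurd htop (edist_ne_top x y)
  -- A curve of length less than r is mapped to one of length at most C * r. An r above the distance
  -- is used since the infimum of lengths need not be attained.
  have key : ∀ r : ℝ≥0∞, Manifold.riemannianEDist (𝓡 n) x y < r →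
      Manifold.riemannianEDist (𝓡 n) (φ x) (φ y) ≤ C * r := by
    intro r hr
    obtain ⟨γ, h0, h1, hγ, hlen, -, -⟩ :=
      Manifold.exists_lt_locally_constant_of_riemannianEDist_lt hr zero_lt_one
    have hcomp : ContMDiff 𝓘(ℝ, ℝ) (𝓡 n) 1 (φ ∘ γ) := hφ.comp hγ
    refine (Manifold.riemannianEDist_le_pathELength (γ := φ ∘ γ) (a := 0) (b := 1)
      hcomp.contMDiffOn (by simp [h0]) (by simp [h1]) zero_le_one).trans ?_
    refine le_trans ?_ (mul_le_mul_right hlen.le (C : ℝ≥0∞))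
    rw [Manifold.pathELength_eq_lintegral_mfderiv_Icc, Manifold.pathELength_eq_lintegral_mfderiv_Icc,
      ← lintegral_const_mul' _ _ ENNReal.coe_ne_top]
    refine lintegral_mono fun s => ?_
    have hd : mfderiv 𝓘(ℝ, ℝ) (𝓡 n) (φ ∘ γ) s =
        (mfderiv (𝓡 n) (𝓡 n) φ (γ s)).comp (mfderiv 𝓘(ℝ, ℝ) (𝓡 n) γ s) :=
      mfderiv_comp s (hφ.mdifferentiableAt one_ne_zero) (hγ.mdifferentiableAt one_ne_zero)
    rw [hd]
    have h := (mfderiv (𝓡 n) (𝓡 n) φ (γ s)).le_of_opNorm_le (hC (γ s))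
      (mfderiv 𝓘(ℝ, ℝ) (𝓡 n) γ s 1)
    rw [← ofReal_norm, ← ofReal_norm, ← ENNReal.ofReal_coe_nnreal]
    exact (ENNReal.ofReal_le_ofReal h).trans_eq (ENNReal.ofReal_mul C.2)
  refine ENNReal.le_of_forall_pos_le_add fun ε hε _ => ?_
  rcases eq_or_ne C 0 with hC0 | hC0
  · subst hC0
    have := key (Manifold.riemannianEDist (𝓡 n) x y + 1) (ENNReal.lt_add_right htop one_ne_zero)
    simp at this
    simp [this]
  have hlt : Manifold.riemannianEDist (𝓡 n) x y <
      Manifold.riemannianEDist (𝓡 n) x y + (ε / C : ℝ≥0) :=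
    ENNReal.lt_add_right htop (by
      have : (0 : ℝ≥0) < ε / C := div_pos hε (pos_iff_ne_zero.2 hC0)
      exact_mod_cast this.ne')
  refine (key _ hlt).trans ?_
  rw [mul_add, ← ENNReal.coe_mul, mul_div_cancel₀ _ hC0]

/-- Indicators of closed sets are pointwise limits of bounded continuous functions, and finite Borel
measures are inner regular for closed sets. Jacobian bounds can thus be proved, and passed to
limits, by means of continuous functions. -/
theorem le_smul_of_forall_lintegral_le {Ω : Type*} [MeasurableSpace Ω] [TopologicalSpace Ω]
    [TopologicalSpace.PseudoMetrizableSpace Ω] [BorelSpace Ω] {μ ν : Measure Ω} [IsFiniteMeasure μ]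
    [IsFiniteMeasure ν] (C : ℝ≥0)
    (h : ∀ g : BoundedContinuousFunction Ω ℝ≥0, ∫⁻ x, g x ∂μ ≤ C * ∫⁻ x, g x ∂ν) : μ ≤ C • ν := by
  have hclosed : ∀ G : Set Ω, IsClosed G → μ G ≤ C * ν G := fun G hG =>
    le_of_tendsto_of_tendsto' (HasOuterApproxClosed.tendsto_lintegral_apprSeq hG μ)
      (ENNReal.Tendsto.const_mul (HasOuterApproxClosed.tendsto_lintegral_apprSeq hG ν) (Or.inr ENNReal.coe_ne_top))
      fun n => h _
  refine Measure.le_iff.2 fun s hs => ?_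
  rw [hs.measure_eq_iSup_isClosed_of_ne_top (measure_ne_top μ s)]
  refine iSup₂_le fun G hGs => iSup_le fun hG => ?_
  refine (hclosed G hG).trans ?_
  rw [Measure.smul_apply, ENNReal.smul_def, smul_eq_mul]
  gcongr

/-- The extremal test function is the sign of f, which is approximated in L¹ by continuous
functions; boundedness of f controls the error. This is what turns weak* information into L¹
information. -/
theorem integral_abs_le_of_forall_continuous {Ω : Type*} [MeasurableSpace Ω] [TopologicalSpace Ω]
    [TopologicalSpace.MetrizableSpace Ω] [BorelSpace Ω] {μ : Measure Ω} [IsFiniteMeasure μ]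
    {f : Ω → ℝ} (hf : Measurable f) {c ε : ℝ} (hc : ∀ x, |f x| ≤ c)
    (h : ∀ a : Ω → ℝ, Continuous a → (∀ x, |a x| ≤ 1) → ∫ x, a x * f x ∂μ ≤ ε) :
    ∫ x, |f x| ∂μ ≤ ε := by
  let := TopologicalSpace.metrizableSpaceMetric Ω
  refine le_of_forall_pos_le_add fun δ hδ => ?_
  have hc1 : 0 < |c| + 1 := by positivity
  set s : Ω → ℝ := fun x => if 0 ≤ f x then 1 else -1 with hs
  have hsm : Measurable s := Measurable.ite (measurableSet_le measurable_const hf)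
    measurable_const measurable_const
  have hs1 : ∀ x, |s x| ≤ 1 := fun x => by by_cases hx : 0 ≤ f x <;> simp [hs, hx]
  have hsf : ∀ x, |f x| = s x * f x := fun x => by
    by_cases hx : 0 ≤ f x
    · simp [hs, hx, abs_of_nonneg]
    · simp [hs, hx, abs_of_neg (not_le.1 hx)]
  have hsi : Integrable s μ := Integrable.of_bound hsm.aestronglyMeasurable 1 (ae_of_all _ hs1)
  obtain ⟨a, ha, hai⟩ := hsi.exists_boundedContinuous_integral_sub_le
    (ε := δ / (|c| + 1)) (by positivity)
  -- Truncation to [-1, 1] does not worsen the approximation, because s already takes its values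
  -- there.
  set b : Ω → ℝ := fun x => max (-1) (min (a x) 1) with hb
  have hbc : Continuous b := by fun_prop
  have hb1 : ∀ x, |b x| ≤ 1 := fun x => abs_le.2
    ⟨le_max_left _ _, max_le (by norm_num) (min_le_right _ _)⟩
  have hsb : ∀ x, |s x - b x| ≤ |s x - a x| := fun x => by
    have := abs_le.1 (hs1 x)
    have h1 : s x = max (-1) (min (s x) 1) := by rw [min_eq_left this.2, max_eq_right this.1]
    conv_lhs => rw [h1]
    exact (abs_max_sub_max_le_max _ _ _ _).trans
      (max_le (by simp) ((abs_min_sub_min_le_max _ _ _ _).trans (max_le le_rfl (by simp))))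
  have hint : ∀ g : Ω → ℝ, Measurable g → (∀ x, |g x| ≤ 1) → Integrable (fun x => g x * f x) μ :=
    fun g hg hg1 => Integrable.of_bound (hg.mul hf).aestronglyMeasurable (1 * c)
      (ae_of_all _ fun x => by
        rw [Real.norm_eq_abs, abs_mul]; exact mul_le_mul (hg1 x) (hc x) (abs_nonneg _) zero_le_one)
  have hsbi : Integrable (fun x => |s x - a x|) μ := (hsi.sub hai).abs
  have e1 : ∫ x, |f x| ∂μ = ∫ x, b x * f x ∂μ + ∫ x, (s x * f x - b x * f x) ∂μ := by
    rw [integral_sub (hint s hsm hs1) (hint b hbc.measurable hb1)]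
    simp only [hsf]; ring
  rw [e1]
  refine add_le_add (h b hbc hb1) ?_
  calc ∫ x, (s x * f x - b x * f x) ∂μ ≤ ∫ x, (|c| + 1) * |s x - a x| ∂μ := by
        refine integral_mono ((hint s hsm hs1).sub (hint b hbc.measurable hb1))
          (hsbi.const_mul _) fun x => ?_
        calc s x * f x - b x * f x = (s x - b x) * f x := by ring
          _ ≤ |s x - b x| * |f x| := by rw [← abs_mul]; exact le_abs_self _
          _ ≤ |s x - a x| * (|c| + 1) := mul_le_mul (hsb x)
              ((hc x).trans ((le_abs_self c).trans (by linarith))) (abs_nonneg _) (abs_nonneg _)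
          _ = _ := mul_comm _ _
    _ = (|c| + 1) * ∫ x, |s x - a x| ∂μ := integral_const_mul _ _
    _ ≤ (|c| + 1) * (δ / (|c| + 1)) := by gcongr; simpa using ha
    _ = δ := by field_simp

end UStates

/-! ### The Grassmannian as a compact metric space of projections -/

namespace UStates

open scoped NNReal ENNReal

namespace Grass

variable {l d : ℕ}

/-- The orthogonal projection onto a subspace, as an operator. -/
noncomputable def proj (V : Grass l d) : EuclideanSpace ℂ (Fin d) →L[ℂ] EuclideanSpace ℂ (Fin d) :=
  V.1.starProjection

theorem isInducing_proj : IsInducing (proj : Grass l d → _) := ⟨rfl⟩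

theorem proj_injective : Function.Injective (proj : Grass l d → _) := by
  intro V W h
  have h1 := congrArg (fun T : EuclideanSpace ℂ (Fin d) →L[ℂ] EuclideanSpace ℂ (Fin d) => T.range) h
  simp only [proj, Submodule.range_starProjection] at h1
  exact Subtype.ext h1

theorem isEmbedding_proj : IsEmbedding (proj : Grass l d → _) := ⟨isInducing_proj, proj_injective⟩

theorem trace_proj (V : Grass l d) :
    LinearMap.trace ℂ _ ((proj V : EuclideanSpace ℂ (Fin d) →L[ℂ] EuclideanSpace ℂ (Fin d)) :
      EuclideanSpace ℂ (Fin d) →ₗ[ℂ] EuclideanSpace ℂ (Fin d)) = l := by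
  have h : LinearMap.IsProj V.1 ((proj V : EuclideanSpace ℂ (Fin d) →L[ℂ] _) :
      EuclideanSpace ℂ (Fin d) →ₗ[ℂ] EuclideanSpace ℂ (Fin d)) :=
    ⟨fun x => V.1.starProjection_apply_mem x, fun x hx => Submodule.starProjection_eq_self_iff.2 hx⟩
  rw [h.trace, V.2]

/-- The trace of a projection is its rank, so the dimension becomes a closed condition on operators,
which gives compactness. -/
theorem range_proj : Set.range (proj : Grass l d → _) =
    {T : EuclideanSpace ℂ (Fin d) →L[ℂ] EuclideanSpace ℂ (Fin d) | T * T = T ∧ star T = T ∧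
      LinearMap.trace ℂ _ (T : EuclideanSpace ℂ (Fin d) →ₗ[ℂ] EuclideanSpace ℂ (Fin d)) = l} := by
  ext T
  constructor
  · rintro ⟨V, rfl⟩
    exact ⟨V.1.isIdempotentElem_starProjection, isSelfAdjoint_starProjection V.1, trace_proj V⟩
  · rintro ⟨h1, h2, h3⟩
    obtain ⟨_, hT⟩ := isStarProjection_iff_eq_starProjection_range.1 (⟨h1, h2⟩ : IsStarProjection T)
    have hr : Module.finrank ℂ T.range = l := by
      have h : LinearMap.IsProj T.range (T :
          EuclideanSpace ℂ (Fin d) →ₗ[ℂ] EuclideanSpace ℂ (Fin d)) := by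
        refine ⟨fun x => ⟨x, rfl⟩, ?_⟩
        rintro _ ⟨x, rfl⟩
        exact congrArg (fun U : EuclideanSpace ℂ (Fin d) →L[ℂ] EuclideanSpace ℂ (Fin d) => U x) h1
      have := h.trace
      rw [h3] at this
      exact_mod_cast this.symm
    exact ⟨⟨T.range, hr⟩, hT.symm⟩

theorem isClosedEmbedding_proj : IsClosedEmbedding (proj : Grass l d → _) := by
  refine ⟨isEmbedding_proj, ?_⟩
  rw [range_proj]
  refine (isClosed_eq (by fun_prop) continuous_id).inter
    ((isClosed_eq
      (ContinuousLinearMap.adjoint (𝕜 := ℂ) (E := EuclideanSpace ℂ (Fin d))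
        (F := EuclideanSpace ℂ (Fin d))).continuous continuous_id).inter (isClosed_eq ?_ continuous_const))
  exact LinearMap.continuous_of_finiteDimensional
    ((LinearMap.trace ℂ (EuclideanSpace ℂ (Fin d))) ∘ₗ
      (ContinuousLinearMap.coeLM ℂ : (EuclideanSpace ℂ (Fin d) →L[ℂ] EuclideanSpace ℂ (Fin d)) →ₗ[ℂ] _))

instance : CompactSpace (Grass l d) := by
  refine ⟨isClosedEmbedding_proj.isInducing.isCompact_iff.2 ?_⟩
  rw [Set.image_univ]
  refine Metric.isCompact_of_isClosed_isBounded isClosedEmbedding_proj.isClosed_range ?_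
  refine (Metric.isBounded_iff_subset_closedBall 0).2 ⟨1, ?_⟩
  rintro _ ⟨V, rfl⟩
  rw [mem_closedBall_zero_iff]
  exact V.1.starProjection_norm_le

noncomputable instance : MetricSpace (Grass l d) :=
  isEmbedding_proj.comapMetricSpace _

theorem dist_eq (V W : Grass l d) : dist V W = ‖proj V - proj W‖ := dist_eq_norm (proj V) (proj W)

/-- With P, Q the projections onto V and its image, Q - P = (1 - P)Q - P(1 - Q), and P(1 - Q) is the
adjoint of (1 - Q)P. Since B moves vectors of V little, (1 - Q)P has norm at most δ. The bound 1/2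
gives ‖w‖ ≤ 2‖Bw‖, whence 2δ for the other term. -/
theorem dist_map_le (B : EuclideanSpace ℂ (Fin d) ≃L[ℂ] EuclideanSpace ℂ (Fin d))
    (hB : ‖(B : EuclideanSpace ℂ (Fin d) →L[ℂ] EuclideanSpace ℂ (Fin d)) -
      ContinuousLinearMap.id ℂ (EuclideanSpace ℂ (Fin d))‖ ≤ 1 / 2) (V : Grass l d) :
    dist (Grass.map B V) V ≤ 3 * ‖(B : EuclideanSpace ℂ (Fin d) →L[ℂ] EuclideanSpace ℂ (Fin d)) -
      ContinuousLinearMap.id ℂ (EuclideanSpace ℂ (Fin d))‖ := by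
  set δ := ‖(B : EuclideanSpace ℂ (Fin d) →L[ℂ] EuclideanSpace ℂ (Fin d)) -
      ContinuousLinearMap.id ℂ (EuclideanSpace ℂ (Fin d))‖ with hδ
  have hδ0 : 0 ≤ δ := norm_nonneg _
  set P := proj V
  set Q := proj (Grass.map B V)
  have hPs : star P = P := isSelfAdjoint_starProjection V.1
  have hQs : star Q = Q := isSelfAdjoint_starProjection (Grass.map B V).1
  have hdiff : ∀ v, ‖B v - v‖ ≤ δ * ‖v‖ := fun v =>
    ((B : EuclideanSpace ℂ (Fin d) →L[ℂ] EuclideanSpace ℂ (Fin d)) -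
      ContinuousLinearMap.id ℂ (EuclideanSpace ℂ (Fin d))).le_opNorm v
  have hP1 : ∀ v, ‖P v‖ ≤ ‖v‖ := fun v => V.1.norm_starProjection_apply_le v
  have hcompl : ∀ (W : Grass l d) (v : EuclideanSpace ℂ (Fin d)), ‖v - proj W v‖ ≤ ‖v‖ := by
    intro W v
    have := W.1ᗮ.norm_starProjection_apply_le v
    rwa [Submodule.starProjection_orthogonal'] at this
  have hfix : ∀ (W : Grass l d) (v : EuclideanSpace ℂ (Fin d)), v ∈ W.1 → proj W v = v :=
    fun W v hv => Submodule.starProjection_eq_self_iff.2 hv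
  have hclose : ∀ (W : Grass l d) (v w : EuclideanSpace ℂ (Fin d)), w ∈ W.1 →
      ‖v - proj W v‖ ≤ ‖v - w‖ := by
    intro W v w hw
    have h := hcompl W (v - w)
    rw [map_sub, hfix W w hw] at h
    convert h using 2
    abel
  have h1 : ‖(1 - Q) * P‖ ≤ δ := by
    refine ContinuousLinearMap.opNorm_le_bound _ hδ0 fun v => ?_
    have hm : B (P v) ∈ (Grass.map B V).1 :=
      Submodule.mem_map_of_mem (V.1.starProjection_apply_mem v)
    calc ‖((1 - Q) * P) v‖ = ‖P v - Q (P v)‖ := rfl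
      _ ≤ ‖P v - B (P v)‖ := hclose _ _ _ hm
      _ ≤ δ * ‖P v‖ := by rw [norm_sub_rev]; exact hdiff _
      _ ≤ δ * ‖v‖ := by gcongr; exact hP1 v
  have h2 : ‖(1 - P) * Q‖ ≤ 2 * δ := by
    refine ContinuousLinearMap.opNorm_le_bound _ (by positivity) fun v => ?_
    obtain ⟨w, hw, hwv⟩ : ∃ w ∈ V.1, B w = Q v :=
      (Submodule.mem_map.1 ((Grass.map B V).1.starProjection_apply_mem v))
    have hQv : ‖Q v‖ ≤ ‖v‖ := (Grass.map B V).1.norm_starProjection_apply_le v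
    have hwn : ‖w‖ ≤ 2 * ‖v‖ := by
      have h3 := hdiff w
      have h4 : ‖w‖ ≤ ‖B w‖ + ‖B w - w‖ := by
        have := norm_sub_le (B w) (B w - w)
        rwa [sub_sub_cancel] at this
      rw [hwv] at h4 h3
      nlinarith [norm_nonneg w]
    calc ‖((1 - P) * Q) v‖ = ‖Q v - P (Q v)‖ := rfl
      _ ≤ ‖Q v - w‖ := hclose _ _ _ hw
      _ = ‖B w - w‖ := by rw [hwv]
      _ ≤ δ * ‖w‖ := hdiff _
      _ ≤ δ * (2 * ‖v‖) := by gcongr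
      _ = 2 * δ * ‖v‖ := by ring
  have h3 : ‖P * (1 - Q)‖ ≤ δ := by
    have : P * (1 - Q) = star ((1 - Q) * P) := by
      rw [star_mul, hPs, ContinuousLinearMap.star_eq_adjoint (1 - Q), map_sub,
        ← ContinuousLinearMap.star_eq_adjoint, ← ContinuousLinearMap.star_eq_adjoint, hQs, star_one]
    rw [this, ContinuousLinearMap.star_eq_adjoint, LinearIsometryEquiv.norm_map]
    exact h1
  rw [dist_eq]
  calc ‖Q - P‖ = ‖(1 - P) * Q - P * (1 - Q)‖ := by
        congr 1; rw [sub_mul, mul_sub, one_mul, mul_one]; abel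
    _ ≤ 2 * δ + δ := (norm_sub_le _ _).trans (add_le_add h2 h3)
    _ = 3 * δ := by ring

end Grass

end UStates

/-! ### The shift, fibre iterates and strong-unstable holonomies -/

namespace UStates

open scoped NNReal ENNReal

section Shift

variable {X : Set ℕ}

theorem shiftBy_zero (x : ℤ → X) : shiftBy 0 x = x := by
  funext k; simp [shiftBy]

theorem shiftBy_shiftBy (a b : ℤ) (x : ℤ → X) : shiftBy a (shiftBy b x) = shiftBy (b + a) x := by
  funext k; simp only [shiftBy]; congr 1; ring

theorem continuous_shiftBy (a : ℤ) : Continuous (shiftBy a : (ℤ → X) → (ℤ → X)) :=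
  continuous_pi fun k => continuous_apply (k + a)

theorem continuous_future : Continuous (future : (ℤ → X) → (ℕ → X)) :=
  continuous_pi fun k => continuous_apply (k : ℤ)

theorem continuous_glue : Continuous fun p : (ℕ → X) × (ℕ → X) => glue p.1 p.2 := by
  refine continuous_pi fun k => ?_
  cases k with
  | ofNat k => exact (continuous_apply k).comp continuous_snd
  | negSucc k => exact (continuous_apply k).comp continuous_fst

theorem future_glue (xs xu : ℕ → X) : future (glue xs xu) = xu := rfl

theorem glue_surjective : Function.Surjective fun p : (ℕ → X) × (ℕ → X) => glue p.1 p.2 := by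
  intro x
  refine ⟨(fun k => x (Int.negSucc k), future x), ?_⟩
  funext k
  cases k <;> rfl

theorem glue_eq_of_lt {x y : ℕ → X} {N : ℕ} (h : ∀ k < N, x k = y k) (xs : ℕ → X) {k : ℤ}
    (hk : k < N) : glue xs x k = glue xs y k := by
  cases k with
  | ofNat k => exact h k (by simpa using hk)
  | negSucc k => rfl

theorem shiftDist_nonneg (x y : ℤ → X) : 0 ≤ shiftDist x y :=
  tsum_nonneg fun k => by split_ifs <;> positivity

theorem shiftDist_le {x y : ℤ → X} {N : ℕ} (h : ∀ k : ℤ, k < N → x k = y k) :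
    shiftDist x y ≤ 2 * (1 / 2) ^ N := by
  classical
  unfold shiftDist
  have hinj : Function.Injective fun j : ℕ => (N : ℤ) + j := fun a b hab => by
    simpa using hab
  rw [← hinj.tsum_eq]
  · have hg : HasSum (fun j : ℕ => (1 / 2 : ℝ) ^ N * (1 / 2) ^ j) ((1 / 2) ^ N * 2) :=
      hasSum_geometric_two.mul_left _
    rw [mul_comm, ← hg.tsum_eq]
    have hle : ∀ j : ℕ, (if x ((N : ℤ) + j) = y ((N : ℤ) + j) then (0 : ℝ)
        else (1 / 2 : ℝ) ^ ((N : ℤ) + j).natAbs) ≤ (1 / 2 : ℝ) ^ N * (1 / 2) ^ j := fun j => by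
      split_ifs
      · positivity
      · rw [← pow_add]; exact le_of_eq (congrArg _ (by omega))
    refine Summable.tsum_le_tsum (fun j => ?_) (Summable.of_nonneg_of_le (fun j => ?_) (fun j => ?_)
      hg.summable) hg.summable
    · convert hle j
    · split_ifs <;> positivity
    · convert hle j
  · intro k hk
    refine ⟨(k - N).toNat, ?_⟩
    have : (N : ℤ) ≤ k := by
      by_contra hlt
      exact hk (if_pos (h k (not_le.1 hlt)))
    show (N : ℤ) + ((k - N).toNat : ℤ) = k
    omega

end Shift

section Dynamics

variable {X : Set ℕ} {n : ℕ} {K : Type*} [MetricSpace K]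
  [ChartedSpace (EuclideanSpace ℝ (Fin n)) K]
  [RiemannianBundle (fun t : K => TangentSpace (𝓡 n) t)]

namespace SkewProduct

theorem fwd_succ_apply (F : SkewProduct X n K) (x : ℤ → X) (m : ℕ) (t : K) :
    F.fwd x (m + 1) t = F.fib (shiftBy m x) (F.fwd x m t) := rfl

theorem fwd_succ_apply' (F : SkewProduct X n K) (x : ℤ → X) (m : ℕ) (t : K) :
    F.fwd x (m + 1) t = F.fwd (shiftBy 1 x) m (F.fib x t) := by
  induction m with
  | zero =>
    rw [fwd_succ_apply]
    simp only [Nat.cast_zero, shiftBy_zero]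
    rfl
  | succ m ih =>
    rw [fwd_succ_apply, ih, fwd_succ_apply, shiftBy_shiftBy, add_comm (1 : ℤ), Nat.cast_succ]

theorem map_iterate (F : SkewProduct X n K) (m : ℕ) (p : (ℤ → X) × K) :
    F.map^[m] p = (shiftBy m p.1, F.fwd p.1 m p.2) := by
  induction m with
  | zero => exact Prod.ext (shiftBy_zero p.1).symm rfl
  | succ m ih =>
    rw [Function.iterate_succ_apply', ih]
    refine Prod.ext ?_ rfl
    simp only [SkewProduct.map, shiftBy_shiftBy, Nat.cast_succ]

theorem isHomeomorph_map_iterate (F : SkewProduct X n K) (m : ℕ) : IsHomeomorph F.map^[m] := by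
  induction m with
  | zero => exact IsHomeomorph.id
  | succ m ih => rw [Function.iterate_succ']; exact F.isHomeomorph.comp ih

theorem continuous_fwd (F : SkewProduct X n K) (m : ℕ) :
    Continuous fun p : (ℤ → X) × K => F.fwd p.1 m p.2 := by
  have := continuous_snd.comp (F.isHomeomorph_map_iterate m).continuous
  refine this.congr fun p => ?_
  simp only [Function.comp_apply, map_iterate]

/-- Joint continuity of the inverses does not follow fibre by fibre; it is read off from the inverse
of the global homeomorphism. -/
theorem continuous_fwd_symm (F : SkewProduct X n K) (m : ℕ) :
    Continuous fun p : (ℤ → X) × K => (F.fwd p.1 m).symm p.2 := by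
  have h : Continuous fun p : (ℤ → X) × K =>
      (((F.isHomeomorph_map_iterate m).homeomorph).symm (shiftBy m p.1, p.2)).2 :=
    continuous_snd.comp ((Homeomorph.continuous_symm _).comp
      (((continuous_shiftBy m).comp continuous_fst).prodMk continuous_snd))
  refine h.congr fun p => ?_
  have : ((F.isHomeomorph_map_iterate m).homeomorph).symm (shiftBy m p.1, p.2) =
      (p.1, (F.fwd p.1 m).symm p.2) := by
    rw [Homeomorph.symm_apply_eq, IsHomeomorph.homeomorph_apply, map_iterate]
    exact Prod.ext rfl ((F.fwd p.1 m).apply_symm_apply p.2).symm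
  rw [this]

/-- The inverse of the m-th iterate from x is the iterate of order -m from the m-th shift of x, so
neutrality over all integers bounds both. -/
theorem exists_lipschitzWith [IsManifold (𝓡 n) ∞ K] [IsRiemannianManifold (𝓡 n) K] {F : SkewProduct X n K}
    (hF : F.MostlyNeutral) :
    ∃ C : ℝ≥0, ∀ x m, LipschitzWith C (F.fwd x m) ∧ LipschitzWith C (F.fwd x m).symm := by
  obtain ⟨C, hC⟩ := hF
  refine ⟨C.toNNReal, fun x m => ⟨?_, ?_⟩⟩
  · exact lipschitzWith_of_norm_mfderiv_le (F.fwd x m).contMDiff_toFun fun t =>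
      (hC x (Int.ofNat m) t).trans (Real.le_coe_toNNReal C)
  · refine lipschitzWith_of_norm_mfderiv_le (F.fwd x m).symm.contMDiff_toFun fun t => ?_
    cases m with
    | zero => exact (hC x 0 t).trans (Real.le_coe_toNNReal C)
    | succ m =>
      have h : ∀ z, shiftBy (Int.negSucc m) z = x →
          ‖mfderiv (𝓡 n) (𝓡 n) (F.fwd x (m + 1)).symm t‖ ≤ C.toNNReal := by
        rintro z rfl
        exact (hC z (Int.negSucc m) t).trans (Real.le_coe_toNNReal C)
      refine h (shiftBy (m + 1 : ℕ) x) ?_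
      rw [shiftBy_shiftBy, Int.negSucc_eq]
      simpa using shiftBy_zero x

/-- The finite-time approximations of the strong-unstable holonomy between the fibres of `x`
and `y`. -/
noncomputable def holApprox (F : SkewProduct X n K) (x y : ℤ → X) (m : ℕ) (t : K) : K :=
  (F.iter y (-(m : ℤ))).symm (F.iter x (-(m : ℤ)) t)

theorem holApprox_eq (F : SkewProduct X n K) (x y : ℤ → X) (m : ℕ) (t : K) :
    F.holApprox x y m t =
      F.fwd (shiftBy (-m) y) m ((F.fwd (shiftBy (-m) x) m).symm t) := by
  cases m <;> rfl

theorem continuous_holApprox (F : SkewProduct X n K) (m : ℕ) :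
    Continuous fun p : ((ℤ → X) × (ℤ → X)) × K => F.holApprox p.1.1 p.1.2 m p.2 := by
  simp only [holApprox_eq]
  exact (F.continuous_fwd m).comp (((continuous_shiftBy _).comp (by fun_prop)).prodMk
    ((F.continuous_fwd_symm m).comp (((continuous_shiftBy _).comp (by fun_prop)).prodMk
      continuous_snd)))

/-- Consecutive approximations are images, under the same forward iterate, of one point v moved by
the fibre maps of the two sequences shifted back by m + 1. Neutrality keeps the outer factor
bounded, and the shift makes the inner distance small. -/
theorem dist_holApprox_succ_le (F : SkewProduct X n K) {C : ℝ≥0}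
    (hC : ∀ x m, LipschitzWith C (F.fwd x m)) {c α : ℝ}
    (hc : ∀ (x y : ℤ → X) (t : K), dist (F.fib x t) (F.fib y t) ≤ c * shiftDist x y ^ α)
    (x y : ℤ → X) (m : ℕ) (t : K) :
    dist (F.holApprox x y m t) (F.holApprox x y (m + 1) t) ≤
      C * (c * shiftDist (shiftBy (-(m + 1 : ℕ)) x) (shiftBy (-(m + 1 : ℕ)) y) ^ α) := by
  have hs : ∀ z : ℤ → X, shiftBy 1 (shiftBy (-(m + 1 : ℕ)) z) = shiftBy (-m) z := fun z => by
    rw [shiftBy_shiftBy]; congr 1; push_cast; ring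
  set v := (F.fwd (shiftBy (-(m + 1 : ℕ)) x) (m + 1)).symm t with hv
  have hu : (F.fwd (shiftBy (-m) x) m).symm t = F.fib (shiftBy (-(m + 1 : ℕ)) x) v := by
    have : F.fwd (shiftBy (-(m + 1 : ℕ)) x) (m + 1) v = t := Diffeomorph.apply_symm_apply _ _
    rw [fwd_succ_apply', hs] at this
    rw [← this, Diffeomorph.symm_apply_apply]
  rw [holApprox_eq, holApprox_eq, hu, ← hv, fwd_succ_apply', hs]
  refine ((hC _ _).dist_le_mul _ _).trans ?_
  gcongr
  exact hc _ _ _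

/-- Closeness of the holonomies to the identity, and convergence of their approximations. -/
theorem exists_dist_holApprox_le [IsManifold (𝓡 n) ∞ K] [IsRiemannianManifold (𝓡 n) K] [CompactSpace K]
    {F : SkewProduct X n K} (hF : F.MostlyNeutral) :
    ∃ η : ℕ → ℝ, Tendsto η atTop (𝓝 0) ∧ ∀ (N : ℕ) (x y : ℤ → X),
      (∀ k : ℤ, k < N → x k = y k) → ∀ t, CauchySeq (fun m => F.holApprox x y m t) ∧
        ∀ m, dist (F.holApprox x y m t) t ≤ η N := by
  obtain ⟨C, hC⟩ := exists_lipschitzWith hF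
  obtain ⟨α, hα, ⟨c', hc'⟩, -⟩ := F.holder
  set c := max c' 0
  have hc0 : 0 ≤ c := le_max_right _ _
  have hc : ∀ (x y : ℤ → X) (t : K), dist (F.fib x t) (F.fib y t) ≤ c * shiftDist x y ^ α :=
    fun x y t => (hc' x y t).trans (mul_le_mul_of_nonneg_right (le_max_left _ _)
      (Real.rpow_nonneg (shiftDist_nonneg _ _) _))
  set r : ℝ := (1 / 2) ^ α with hr
  have hr0 : 0 < r := by positivity
  have hr1 : r < 1 := Real.rpow_lt_one (by norm_num) (by norm_num) hα
  set B : ℕ → ℝ := fun N => C * (c * r ^ N) with hB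
  have hB0 : ∀ N, 0 ≤ B N := fun N => by positivity
  have hstep : ∀ (N : ℕ) (x y : ℤ → X), (∀ k : ℤ, k < N → x k = y k) → ∀ t m,
      dist (F.holApprox x y m t) (F.holApprox x y (m + 1) t) ≤ B N * r ^ m := by
    intro N x y hxy t m
    refine (F.dist_holApprox_succ_le (fun x m => (hC x m).1) hc x y m t).trans ?_
    -- After the shift the sequences agree below position N + m + 1; the extra factor 1/2 absorbs
    -- the 2 of `shiftDist_le`.
    have h1 : shiftDist (shiftBy (-(m + 1 : ℕ)) x) (shiftBy (-(m + 1 : ℕ)) y) ≤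
        (1 / 2) ^ (N + m) := by
      refine (shiftDist_le (N := N + (m + 1)) fun k hk => hxy _ ?_).trans ?_
      · push_cast at hk ⊢; omega
      · rw [← add_assoc, pow_succ]; apply le_of_eq; ring
    have h2 : shiftDist (shiftBy (-(m + 1 : ℕ)) x) (shiftBy (-(m + 1 : ℕ)) y) ^ α ≤
        r ^ N * r ^ m := by
      refine (Real.rpow_le_rpow (shiftDist_nonneg _ _) h1 hα.le).trans_eq ?_
      rw [← pow_add, hr, ← Real.rpow_natCast, ← Real.rpow_natCast, ← Real.rpow_mul (by norm_num),
        ← Real.rpow_mul (by norm_num), mul_comm]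
    calc (C : ℝ) * (c * shiftDist (shiftBy (-(m + 1 : ℕ)) x) (shiftBy (-(m + 1 : ℕ)) y) ^ α)
        ≤ C * (c * (r ^ N * r ^ m)) := by gcongr
      _ = B N * r ^ m := by simp only [hB]; ring
  refine ⟨fun N => B N / (1 - r), ?_, fun N x y hxy t => ⟨?_, fun m => ?_⟩⟩
  · have : Tendsto (fun N => C * (c * r ^ N) / (1 - r)) atTop (𝓝 (C * (c * 0) / (1 - r))) :=
      (((tendsto_pow_atTop_nhds_zero_of_lt_one hr0.le hr1).const_mul c).const_mul _).div_const _
    simpa using this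
  · exact cauchySeq_of_le_geometric r (B N) hr1 (hstep N x y hxy t)
  · have h0 : F.holApprox x y 0 t = t := rfl
    rw [dist_comm]
    calc dist t (F.holApprox x y m t) = dist (F.holApprox x y 0 t) (F.holApprox x y m t) := by
          rw [h0]
      _ ≤ ∑ i ∈ Finset.range m, B N * r ^ i :=
          dist_le_range_sum_of_dist_le m fun {k} _ => hstep N x y hxy t k
      _ = B N * ∑ i ∈ Finset.range m, r ^ i := by rw [Finset.mul_sum]
      _ ≤ B N * (1 - r)⁻¹ := by
          gcongr
          rw [← tsum_geometric_of_lt_one hr0.le hr1]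
          exact (summable_geometric_of_lt_one hr0.le hr1).sum_le_tsum _ fun i _ => by positivity
      _ = B N / (1 - r) := rfl

/-- Both approximations end with the same forward iterate over y. The preceding inverses are
compared by applying the inverse over x' to the holonomy approximation from x to x' and to t. The
bound is uniform in m, hence passes to the holonomies. -/
theorem dist_holApprox_holApprox_le (F : SkewProduct X n K) {C : ℝ≥0}
    (hC : ∀ x m, LipschitzWith C (F.fwd x m) ∧ LipschitzWith C (F.fwd x m).symm)
    (x x' y : ℤ → X) (m : ℕ) (t : K) :
    dist (F.holApprox x y m t) (F.holApprox x' y m t) ≤ C * (C * dist (F.holApprox x x' m t) t) := by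
  rw [holApprox_eq, holApprox_eq, holApprox_eq]
  refine ((hC _ _).1.dist_le_mul _ _).trans ?_
  gcongr
  have h := (hC (shiftBy (-m) x') m).2.dist_le_mul
    (F.fwd (shiftBy (-m) x') m ((F.fwd (shiftBy (-m) x) m).symm t)) t
  rwa [Diffeomorph.symm_apply_apply] at h

/-- The strong-unstable holonomy between the fibres of `x` and `y`. -/
noncomputable def hol (F : SkewProduct X n K) (x y : ℤ → X) (t : K) : K :=
  haveI : Nonempty K := ⟨t⟩
  limUnder atTop fun m => F.holApprox x y m t

theorem tendsto_holApprox [IsManifold (𝓡 n) ∞ K] [IsRiemannianManifold (𝓡 n) K] [CompactSpace K]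
    {F : SkewProduct X n K} (hF : F.MostlyNeutral) {x y : ℤ → X}
    (hxy : ∀ k : ℤ, k < 0 → x k = y k) (t : K) :
    Tendsto (fun m => F.holApprox x y m t) atTop (𝓝 (F.hol x y t)) := by
  obtain ⟨η, -, hη⟩ := exists_dist_holApprox_le hF
  have : Nonempty K := ⟨t⟩
  exact CauchySeq.tendsto_limUnder (hη 0 x y (by exact_mod_cast hxy) t).1

/-- Convergence only needs agreement at negative positions, but `Wuu` also asks for position 0, the
first symbol of the future. -/
theorem wuu_hol [IsManifold (𝓡 n) ∞ K] [IsRiemannianManifold (𝓡 n) K] [CompactSpace K]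
    {F : SkewProduct X n K} (hF : F.MostlyNeutral) {x y : ℤ → X}
    (hxy : ∀ k : ℤ, k < 1 → x k = y k) (t : K) : F.Wuu (x, t) (y, F.hol x y t) :=
  ⟨fun k hk => (hxy k (by omega)).symm, tendsto_holApprox hF (fun k hk => hxy k (by omega)) t⟩

/-- The one-sided iterates thereby inherit the Jacobian bounds of the two-sided ones. -/
theorem oneSidedIter_eq_fwd (F : SkewProduct X n K) {f : (ℕ → X) → K → K}
    (hf : ∀ x t, F.fib x t = f (future x) t) (x : ℤ → X) (j : ℕ) (t : K) :
    oneSidedIter f (future x) j t = F.fwd x j t := by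
  induction j with
  | zero => rfl
  | succ j ih =>
    rw [fwd_succ_apply, hf, ← ih]
    simp only [oneSidedIter, Function.comp_apply]
    congr 1

end SkewProduct

end Dynamics

end UStates

/-! ### Uniform Jacobian bounds for the fibre iterates -/

namespace UStates

open scoped NNReal ENNReal

section General

/-- Against a continuous test function the bound passes to the limit by dominated convergence. This
serves for the holonomies and for the limit maps g. -/
theorem map_le_smul_of_tendsto {Ω K ι : Type*} [MeasurableSpace Ω] [MetricSpace K]
    [MeasurableSpace K] [BorelSpace K] {L : Filter ι} [L.NeBot] [L.IsCountablyGenerated]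
    {μ : Measure Ω} [IsFiniteMeasure μ] {ν : Measure K} [IsFiniteMeasure ν] {C : ℝ≥0}
    {h : ι → Ω → K} {g : Ω → K} (hm : ∀ i, Measurable (h i))
    (hle : ∀ i, μ.map (h i) ≤ C • ν) (hlim : ∀ x, Tendsto (fun i => h i x) L (𝓝 (g x))) :
    μ.map g ≤ C • ν := by
  have hg : Measurable g := measurable_of_tendsto_metrizable' L hm (tendsto_pi_nhds.2 hlim)
  refine le_smul_of_forall_lintegral_le C fun φ => ?_
  rw [lintegral_map φ.continuous.measurable.coe_nnreal_ennreal hg]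
  refine le_of_tendsto (tendsto_lintegral_filter_of_dominated_convergence (l := L)
    (fun _ => (nndist φ 0 : ℝ≥0∞)) (Eventually.of_forall fun i =>
      (φ.continuous.measurable.coe_nnreal_ennreal.comp (hm i)))
    (Eventually.of_forall fun i => ae_of_all _ fun x => ?_) ?_
    (ae_of_all _ fun x => ?_)) (Eventually.of_forall fun i => ?_)
  · exact ENNReal.coe_le_coe.2 (by
      have := φ.dist_coe_le_dist (g := 0) (h i x)
      rw [← NNReal.coe_le_coe, coe_nndist]
      simpa [NNReal.dist_eq] using this)
  · simp [lintegral_const, ENNReal.mul_eq_top]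
  · exact ((ENNReal.continuous_coe.comp φ.continuous).tendsto _).comp (hlim x)
  · simp only [Function.comp_apply]
    rw [← lintegral_map (f := fun y => (φ y : ℝ≥0∞))
      φ.continuous.measurable.coe_nnreal_ennreal (hm i)]
    refine (lintegral_mono' (hle i) le_rfl).trans_eq ?_
    rw [lintegral_smul_measure]
    rfl

theorem map_prod_le_smul {Ω K : Type*} [MeasurableSpace Ω] [MeasurableSpace K] {μ : Measure Ω}
    {ν : Measure K} [SFinite μ] [SFinite ν] {C : ℝ≥0} {h : Ω → K → K}
    (hm : Measurable fun p : Ω × K => h p.1 p.2) (hle : ∀ x, ν.map (h x) ≤ C • ν) :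
    (μ.prod ν).map (fun p => (p.1, h p.1 p.2)) ≤ C • μ.prod ν := by
  have hm' : Measurable fun p : Ω × K => (p.1, h p.1 p.2) := measurable_fst.prodMk hm
  refine Measure.le_iff.2 fun s hs => ?_
  rw [Measure.map_apply hm' hs, Measure.prod_apply (hm' hs), Measure.smul_apply,
    Measure.prod_apply hs, ENNReal.smul_def, smul_eq_mul,
    ← lintegral_const_mul _ (measurable_measure_prodMk_left hs)]
  refine lintegral_mono fun x => ?_
  have h1 := hle x (Prod.mk x ⁻¹' s)
  have hx : Measurable (h x) := hm.comp measurable_prodMk_left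
  rw [Measure.map_apply hx (measurable_prodMk_left hs)] at h1
  exact h1

end General

namespace PartialProduct

variable {X : Set ℕ} {K : Type*} [MetricSpace K] [MeasurableSpace K] [BorelSpace K]

instance (μ : PartialProduct X K) : IsProbabilityMeasure μ.μs := μ.isProb_s
instance (μ : PartialProduct X K) : IsProbabilityMeasure μ.μu := μ.isProb_u
instance (μ : PartialProduct X K) : IsProbabilityMeasure μ.μc := μ.isProb_c
instance (μ : PartialProduct X K) : μ.μs.IsOpenPosMeasure := μ.openPos_s
instance (μ : PartialProduct X K) : μ.μu.IsOpenPosMeasure := μ.openPos_u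

/-- The product measure on the two-sided shift space. -/
noncomputable def base (μ : PartialProduct X K) : Measure (ℤ → X) :=
  (μ.μs.prod μ.μu).map fun p => glue p.1 p.2

instance (μ : PartialProduct X K) : IsProbabilityMeasure μ.base :=
  Measure.isProbabilityMeasure_map continuous_glue.aemeasurable

instance (μ : PartialProduct X K) : μ.base.IsOpenPosMeasure :=
  continuous_glue.isOpenPosMeasure_map glue_surjective

theorem measure_eq (μ : PartialProduct X K) : μ.measure =
    (μ.base.prod μ.μc).withDensity fun p => ENNReal.ofReal (μ.ρ p) := by
  have h := Measure.map_prod_map (μ.μs.prod μ.μu) μ.μc continuous_glue.measurable measurable_id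
  rw [Measure.map_id] at h
  rw [base, h]
  rfl

theorem exists_bounds (μ : PartialProduct X K) : ∃ a b : ℝ≥0, 0 < a ∧
    (∀ p, a ≤ μ.ρ p ∧ μ.ρ p ≤ b) ∧
    a • μ.base.prod μ.μc ≤ μ.measure ∧ μ.measure ≤ b • μ.base.prod μ.μc := by
  obtain ⟨a, b, ha, h⟩ := μ.bounded_ρ
  have hm : Measurable fun p => ENNReal.ofReal (μ.ρ p) := μ.continuous_ρ.measurable.ennreal_ofReal
  refine ⟨a.toNNReal, b.toNNReal, by simpa using ha, fun p => ⟨?_, ?_⟩, ?_, ?_⟩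
  · rw [Real.coe_toNNReal a ha.le]; exact (h p).1
  · exact (h p).2.trans (Real.le_coe_toNNReal b)
  · rw [measure_eq, ENNReal.smul_def, ← withDensity_const]
    exact withDensity_mono (ae_of_all _ fun p => ENNReal.ofReal_le_ofReal (h p).1)
  · rw [measure_eq, ENNReal.smul_def, ← withDensity_const]
    exact withDensity_mono (ae_of_all _ fun p => ENNReal.ofReal_le_ofReal (h p).2)

variable {n : ℕ} [ChartedSpace (EuclideanSpace ℝ (Fin n)) K]
  [RiemannianBundle (fun t : K => TangentSpace (𝓡 n) t)]

/-- Needed to pass from almost every to every x in the Jacobian bounds. -/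
theorem continuous_lintegral_fwd (μ : PartialProduct X K) (F : SkewProduct X n K) (m : ℕ)
    (ψ : BoundedContinuousFunction K ℝ≥0) :
    Continuous fun x : ℤ → X => ∫⁻ t, ψ (F.fwd x m t) ∂μ.μc := by
  refine continuous_iff_continuousAt.2 fun x => ?_
  refine tendsto_lintegral_nn_filter_of_le_const (L := 𝓝 x) μ.μc
    (fs := fun y => ψ.compContinuous ⟨F.fwd y m, (F.fwd y m).continuous⟩) (c := nndist ψ 0)
    (f := fun t => ψ (F.fwd x m t))
    (Eventually.of_forall fun y => ae_of_all _ fun t => ?_) (ae_of_all _ fun t => ?_)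
  · have := ψ.dist_coe_le_dist (g := 0) (F.fwd y m t)
    rw [← NNReal.coe_le_coe, coe_nndist]
    simpa [NNReal.dist_eq] using this
  · have h : Continuous fun y : ℤ → X => ψ (F.fwd y m t) :=
      ψ.continuous.comp ((F.continuous_fwd m).comp (continuous_id.prodMk continuous_const))
    exact h.tendsto x

/-- The fibre iterates have bounded Jacobians with respect to the measure on the fibre. -/
theorem exists_map_fwd_le (μ : PartialProduct X K) (F : SkewProduct X n K)
    (hμ : MeasurePreserving F.map μ.measure μ.measure) :
    ∃ C : ℝ≥0, ∀ x m, μ.μc.map (F.fwd x m) ≤ C • μ.μc ∧ μ.μc.map (F.fwd x m).symm ≤ C • μ.μc := by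
  obtain ⟨a, b, ha, -, hlow, hup⟩ := μ.exists_bounds
  have ha0 : (a : ℝ≥0∞) ≠ 0 := by exact_mod_cast ha.ne'
  have hlow' : ∀ g : (ℤ → X) × K → ℝ≥0∞,
      a * ∫⁻ p, g p ∂(μ.base.prod μ.μc) ≤ ∫⁻ p, g p ∂μ.measure := fun g => by
    have h := lintegral_mono' hlow (le_refl g)
    rwa [lintegral_smul_measure] at h
  have hup' : ∀ g : (ℤ → X) × K → ℝ≥0∞,
      ∫⁻ p, g p ∂μ.measure ≤ b * ∫⁻ p, g p ∂(μ.base.prod μ.μc) := fun g => by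
    have h := lintegral_mono' hup (le_refl g)
    rwa [lintegral_smul_measure] at h
  -- The first inequality bounds the Jacobian of the iterate, the second that of its inverse.
  -- Invariance is localized to x in a set B; one factor b / a comes from the density, another from
  -- the base measure, which the shift preserves only up to such a factor.
  have main : ∀ m (ψ : BoundedContinuousFunction K ℝ≥0) (x : ℤ → X),
      (a * a) * ∫⁻ t, ψ (F.fwd x m t) ∂μ.μc ≤ (b * b) * ∫⁻ t, ψ t ∂μ.μc ∧
      (a * a) * ∫⁻ t, ψ t ∂μ.μc ≤ (b * b) * ∫⁻ t, ψ (F.fwd x m t) ∂μ.μc := by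
    intro m ψ
    have hcont := continuous_lintegral_fwd μ F m ψ
    have hψ : Measurable fun t => (ψ t : ℝ≥0∞) := ψ.continuous.measurable.coe_nnreal_ennreal
    have hset : ∀ B : Set (ℤ → X), MeasurableSet B →
        (a * a) * ∫⁻ x in B, ∫⁻ t, ψ (F.fwd x m t) ∂μ.μc ∂μ.base ≤
          (b * b) * (μ.base B * ∫⁻ t, ψ t ∂μ.μc) ∧
        (a * a) * (μ.base B * ∫⁻ t, ψ t ∂μ.μc) ≤
          (b * b) * ∫⁻ x in B, ∫⁻ t, ψ (F.fwd x m t) ∂μ.μc ∂μ.base := by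
      intro B hB
      set B' : Set (ℤ → X) := shiftBy (-m) ⁻¹' B with hB'
      have hB'm : MeasurableSet B' := (continuous_shiftBy _).measurable hB
      have hiff : ∀ x : ℤ → X, shiftBy m x ∈ B' ↔ x ∈ B := fun x => by
        rw [hB', Set.mem_preimage, shiftBy_shiftBy, add_neg_cancel, shiftBy_zero]
      have hpres : ∀ φ : K → ℝ≥0∞, Measurable φ →
          ∫⁻ p, B.indicator (fun _ => 1) p.1 * φ (F.fwd p.1 m p.2) ∂μ.measure =
          ∫⁻ p, B'.indicator (fun _ => 1) p.1 * φ p.2 ∂μ.measure := by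
        intro φ hφ
        have hg : Measurable fun p : (ℤ → X) × K => B'.indicator (fun _ => (1 : ℝ≥0∞)) p.1 * φ p.2 :=
          ((measurable_const.indicator hB'm).comp measurable_fst).mul (hφ.comp measurable_snd)
        rw [← (hμ.iterate m).lintegral_comp hg]
        refine lintegral_congr fun p => ?_
        rw [F.map_iterate]
        congr 1
        by_cases h : p.1 ∈ B
        · rw [Set.indicator_of_mem h, Set.indicator_of_mem ((hiff _).2 h)]
        · rw [Set.indicator_of_notMem h, Set.indicator_of_notMem (mt (hiff _).1 h)]
      have hprod : ∀ (G : Set (ℤ → X)) (φ : (ℤ → X) × K → ℝ≥0∞), MeasurableSet G → Measurable φ →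
          ∫⁻ p, G.indicator (fun _ => 1) p.1 * φ p ∂(μ.base.prod μ.μc) =
            ∫⁻ x in G, ∫⁻ t, φ (x, t) ∂μ.μc ∂μ.base := by
        intro G φ hG hφ
        have hm : Measurable fun p : (ℤ → X) × K => G.indicator (fun _ => (1 : ℝ≥0∞)) p.1 * φ p :=
          ((measurable_const.indicator hG).comp measurable_fst).mul hφ
        rw [lintegral_prod _ hm.aemeasurable, ← lintegral_indicator hG]
        refine lintegral_congr fun x => ?_
        by_cases h : x ∈ G <;> simp [h]
      have hfm : Measurable fun p : (ℤ → X) × K => (ψ (F.fwd p.1 m p.2) : ℝ≥0∞) :=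
        hψ.comp (F.continuous_fwd m).measurable
      have e1 := hprod B (fun p => ψ (F.fwd p.1 m p.2)) hB hfm
      have e2 := hprod B' (fun p => ψ p.2) hB'm (hψ.comp measurable_snd)
      have e3 := hprod B (fun _ => 1) hB measurable_const
      have e4 := hprod B' (fun _ => 1) hB'm measurable_const
      simp only [lintegral_const, measure_univ, mul_one, Measure.restrict_apply, MeasurableSet.univ,
        Set.univ_inter, one_mul] at e2 e3 e4
      have p1 := hpres (fun t => ψ t) hψ
      -- Testing with 1 compares the base measures of B and of its image B' under the shift.
      have p2 := hpres (fun _ => 1) measurable_const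
      simp only [mul_one] at p2
      have l1 := hlow' fun p => B.indicator (fun _ => 1) p.1 * ψ (F.fwd p.1 m p.2)
      have u1 := hup' fun p => B.indicator (fun _ => 1) p.1 * ψ (F.fwd p.1 m p.2)
      have l2 := hlow' fun p => B'.indicator (fun _ => 1) p.1 * ψ p.2
      have u2 := hup' fun p => B'.indicator (fun _ => 1) p.1 * ψ p.2
      have l3 := hlow' fun p => B.indicator (fun _ => 1) p.1
      have u3 := hup' fun p => B.indicator (fun _ => 1) p.1
      have l4 := hlow' fun p => B'.indicator (fun _ => 1) p.1
      have u4 := hup' fun p => B'.indicator (fun _ => 1) p.1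
      rw [e1] at l1 u1
      rw [e2] at l2 u2
      rw [e3] at l3 u3
      rw [e4] at l4 u4
      constructor
      · calc (a * a : ℝ≥0∞) * ∫⁻ x in B, ∫⁻ t, ψ (F.fwd x m t) ∂μ.μc ∂μ.base
            = a * (a * ∫⁻ x in B, ∫⁻ t, ψ (F.fwd x m t) ∂μ.μc ∂μ.base) := mul_assoc _ _ _
          _ ≤ a * (b * ((∫⁻ t, ψ t ∂μ.μc) * μ.base B')) := by
              exact mul_le_mul' le_rfl ((l1.trans p1.le).trans u2)
          _ = b * (∫⁻ t, ψ t ∂μ.μc) * (a * μ.base B') := by ring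
          _ ≤ b * (∫⁻ t, ψ t ∂μ.μc) * (b * μ.base B) := by
              exact mul_le_mul' le_rfl ((l4.trans p2.ge).trans u3)
          _ = _ := by ring
      · calc (a * a : ℝ≥0∞) * (μ.base B * ∫⁻ t, ψ t ∂μ.μc)
            = a * (∫⁻ t, ψ t ∂μ.μc) * (a * μ.base B) := by ring
          _ ≤ a * (∫⁻ t, ψ t ∂μ.μc) * (b * μ.base B') := by
              exact mul_le_mul' le_rfl ((l3.trans p2.le).trans u4)
          _ = b * (a * ((∫⁻ t, ψ t ∂μ.μc) * μ.base B')) := by ring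
          _ ≤ b * (b * ∫⁻ x in B, ∫⁻ t, ψ (F.fwd x m t) ∂μ.μc ∂μ.base) := by
              exact mul_le_mul' le_rfl ((l2.trans p1.ge).trans u1)
          _ = _ := by ring
    -- Full support of the base measure makes an almost everywhere inequality between continuous
    -- functions hold everywhere.
    have hclosed : ∀ {u v : (ℤ → X) → ℝ≥0∞}, Continuous u → Continuous v →
        (u ≤ᵐ[μ.base] v) → ∀ x, u x ≤ v x := by
      intro u v hu hv huv x
      have hd : Dense {x | u x ≤ v x} := Measure.dense_of_ae huv
      have hc : IsClosed {x | u x ≤ v x} := isClosed_le hu hv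
      have : x ∈ closure {x | u x ≤ v x} := hd x
      rwa [hc.closure_eq] at this
    have haa : (a * a : ℝ≥0∞) ≠ ⊤ := ENNReal.mul_ne_top ENNReal.coe_ne_top ENNReal.coe_ne_top
    have hbb : (b * b : ℝ≥0∞) ≠ ⊤ := ENNReal.mul_ne_top ENNReal.coe_ne_top ENNReal.coe_ne_top
    have hca := ENNReal.continuous_const_mul (a := (a * a : ℝ≥0∞)) haa
    have hcb := ENNReal.continuous_const_mul (a := (b * b : ℝ≥0∞)) hbb
    intro x
    constructor
    · refine hclosed (u := fun x => (a * a) * ∫⁻ t, ψ (F.fwd x m t) ∂μ.μc)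
        (v := fun _ => (b * b) * ∫⁻ t, ψ t ∂μ.μc) (hca.comp hcont) continuous_const ?_ x
      refine ae_le_of_forall_setLIntegral_le_of_sigmaFinite (hcont.measurable.const_mul _)
        fun B hB _ => ?_
      rw [lintegral_const_mul _ hcont.measurable, lintegral_const, Measure.restrict_apply_univ,
        mul_assoc (b * b : ℝ≥0∞), mul_comm _ (μ.base B)]
      exact (hset B hB).1
    · refine hclosed (u := fun _ => (a * a) * ∫⁻ t, ψ t ∂μ.μc)
        (v := fun x => (b * b) * ∫⁻ t, ψ (F.fwd x m t) ∂μ.μc) continuous_const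
        (hcb.comp hcont) ?_ x
      refine ae_le_of_forall_setLIntegral_le_of_sigmaFinite measurable_const
        fun B hB _ => ?_
      rw [lintegral_const_mul _ hcont.measurable, lintegral_const, Measure.restrict_apply_univ,
        mul_assoc (a * a : ℝ≥0∞), mul_comm _ (μ.base B)]
      exact (hset B hB).2
  have hdiv : ∀ u v : ℝ≥0∞, (a * a) * u ≤ (b * b) * v → u ≤ ((b * b / (a * a) : ℝ≥0) : ℝ≥0∞) * v := by
    intro u v huv
    have haa : (a * a : ℝ≥0) ≠ 0 := (mul_pos ha ha).ne'
    rw [ENNReal.coe_div haa, ENNReal.coe_mul, ENNReal.coe_mul, div_eq_mul_inv, mul_right_comm,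
      ← div_eq_mul_inv, ENNReal.le_div_iff_mul_le (Or.inl (by simpa using ha0))
      (Or.inl (ENNReal.mul_ne_top ENNReal.coe_ne_top ENNReal.coe_ne_top)), mul_comm u]
    exact huv
  refine ⟨b * b / (a * a), fun x m => ⟨?_, ?_⟩⟩
  · refine le_smul_of_forall_lintegral_le _ fun ψ => ?_
    rw [lintegral_map ψ.continuous.measurable.coe_nnreal_ennreal (F.fwd x m).continuous.measurable]
    exact hdiv _ _ (main m ψ x).1
  · refine le_smul_of_forall_lintegral_le _ fun ψ => ?_
    rw [lintegral_map ψ.continuous.measurable.coe_nnreal_ennreal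
      (F.fwd x m).symm.continuous.measurable]
    have h := (main m (ψ.compContinuous ⟨(F.fwd x m).symm, (F.fwd x m).symm.continuous⟩) x).2
    simp only [BoundedContinuousFunction.compContinuous_apply, ContinuousMap.coe_mk,
      Diffeomorph.symm_apply_apply] at h
    exact hdiv _ _ h

end PartialProduct

end UStates

/-! ### Holonomies between futures over a common past -/

namespace UStates

open scoped NNReal ENNReal

theorem eventually_agree {X : Set ℕ} (x : ℕ → X) (N : ℕ) :
    ∀ᶠ y in 𝓝 x, ∀ k < N, y k = x k := by
  have : ∀ k ∈ Finset.range N, ∀ᶠ y : ℕ → X in 𝓝 x, y k = x k := fun k _ =>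
    (continuous_apply k).tendsto x (isOpen_discrete {x k} |>.mem_nhds rfl)
  filter_upwards [(Finset.eventually_all (Finset.range N)).2 this] with y hy k hk
  exact hy k (Finset.mem_range.2 hk)

section Holonomy

variable {X : Set ℕ} {n : ℕ} {K : Type*} [MetricSpace K] [CompactSpace K]
  [ChartedSpace (EuclideanSpace ℝ (Fin n)) K] [IsManifold (𝓡 n) ∞ K]
  [RiemannianBundle (fun t : K => TangentSpace (𝓡 n) t)] [IsRiemannianManifold (𝓡 n) K]
  {F : SkewProduct X n K}

namespace SkewProduct

theorem tendsto_holApprox_glue (hF : F.MostlyNeutral) (xs x y : ℕ → X) (t : K) :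
    Tendsto (fun m => F.holApprox (glue xs x) (glue xs y) m t) atTop
      (𝓝 (F.hol (glue xs x) (glue xs y) t)) :=
  tendsto_holApprox hF (fun k hk => glue_eq_of_lt (N := 0) (by simp) xs (by exact_mod_cast hk)) t

theorem exists_dist_hol_le (hF : F.MostlyNeutral) :
    ∃ η : ℕ → ℝ, Tendsto η atTop (𝓝 0) ∧ ∀ (N : ℕ) (x y : ℕ → X), (∀ k < N, x k = y k) →
      ∀ xs t, dist (F.hol (glue xs x) (glue xs y) t) t ≤ η N := by
  obtain ⟨η, h0, hη⟩ := exists_dist_holApprox_le hF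
  refine ⟨η, h0, fun N x y hxy xs t => ?_⟩
  refine le_of_tendsto ((tendsto_holApprox_glue hF xs x y t).dist tendsto_const_nhds)
    (Eventually.of_forall fun m => ?_)
  exact (hη N _ _ (fun k hk => glue_eq_of_lt hxy xs hk) t).2 m

theorem tendsto_hol_left (hF : F.MostlyNeutral) (xs x y : ℕ → X) (t : K) :
    Tendsto (fun x' => F.hol (glue xs x') (glue xs y) t) (𝓝 x)
      (𝓝 (F.hol (glue xs x) (glue xs y) t)) := by
  obtain ⟨η, h0, hη⟩ := exists_dist_holApprox_le hF
  obtain ⟨C, hC⟩ := exists_lipschitzWith hF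
  have hle : ∀ (N : ℕ) (x' : ℕ → X), (∀ k < N, x' k = x k) →
      dist (F.hol (glue xs x') (glue xs y) t) (F.hol (glue xs x) (glue xs y) t) ≤
        C * (C * η N) := by
    intro N x' hx'
    refine le_of_tendsto ((tendsto_holApprox_glue hF xs x' y t).dist
      (tendsto_holApprox_glue hF xs x y t)) (Eventually.of_forall fun m => ?_)
    refine (F.dist_holApprox_holApprox_le hC _ _ _ m t).trans ?_
    gcongr
    exact (hη N _ _ (fun k hk => glue_eq_of_lt hx' xs hk) t).2 m
  have hlim : Tendsto (fun N => (C : ℝ) * (C * η N)) atTop (𝓝 0) := by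
    simpa using (h0.const_mul (C : ℝ)).const_mul (C : ℝ)
  refine Metric.tendsto_nhds.2 fun ε hε => ?_
  obtain ⟨N, hN⟩ := (hlim.eventually (gt_mem_nhds hε)).exists
  filter_upwards [eventually_agree x N] with x' hx'
  exact (hle N x' hx').trans_lt hN

variable [MeasurableSpace K] [BorelSpace K]

theorem measurable_hol (hF : F.MostlyNeutral) (x y : ℕ → X) :
    Measurable fun p : (ℕ → X) × K => F.hol (glue p.1 x) (glue p.1 y) p.2 := by
  refine measurable_of_tendsto_metrizable (f := fun m (p : (ℕ → X) × K) =>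
    F.holApprox (glue p.1 x) (glue p.1 y) m p.2) (fun m => ?_)
    (tendsto_pi_nhds.2 fun p => tendsto_holApprox_glue hF p.1 x y p.2)
  have hg : ∀ z : ℕ → X, Continuous fun p : (ℕ → X) × K => glue p.1 z := fun z =>
    continuous_glue.comp (continuous_fst.prodMk continuous_const)
  exact ((F.continuous_holApprox m).comp
    (((hg x).prodMk (hg y)).prodMk continuous_snd)).measurable

/-- Each approximation is a forward iterate after an inverse iterate, so its Jacobian is at most C *
C whatever m is; this passes to the limit over each past. -/
theorem exists_map_hol_le (hF : F.MostlyNeutral) (μ : PartialProduct X K)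
    (hμ : MeasurePreserving F.map μ.measure μ.measure) :
    ∃ C : ℝ≥0, ∀ x y : ℕ → X, (μ.μs.prod μ.μc).map
      (fun p => (p.1, F.hol (glue p.1 x) (glue p.1 y) p.2)) ≤ C • μ.μs.prod μ.μc := by
  obtain ⟨C, hC⟩ := μ.exists_map_fwd_le F hμ
  refine ⟨C * C, fun x y => map_prod_le_smul (h := fun xs t => F.hol (glue xs x) (glue xs y) t)
    (measurable_hol hF x y) fun xs => ?_⟩
  have hm1 : ∀ z m, Measurable (F.fwd z m) := fun z m => (F.fwd z m).continuous.measurable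
  have hm2 : ∀ z m, Measurable (F.fwd z m).symm := fun z m => (F.fwd z m).symm.continuous.measurable
  have he : ∀ m, F.holApprox (glue xs x) (glue xs y) m =
      F.fwd (shiftBy (-m) (glue xs y)) m ∘ (F.fwd (shiftBy (-m) (glue xs x)) m).symm :=
    fun m => funext fun t => F.holApprox_eq _ _ m t
  refine map_le_smul_of_tendsto (L := atTop)
    (h := fun m => F.holApprox (glue xs x) (glue xs y) m) (fun m => ?_) (fun m => ?_)
    (fun t => tendsto_holApprox_glue hF xs x y t)
  · rw [he]; exact (hm1 _ _).comp (hm2 _ _)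
  · rw [he, ← Measure.map_map (hm1 _ _) (hm2 _ _)]
    refine (Measure.map_mono (hC _ m).2 (hm1 _ _)).trans ?_
    rw [Measure.map_smul, mul_smul]
    gcongr
    exact (hC _ m).1

end SkewProduct

end Holonomy

theorem continuous_glue_prod {X : Set ℕ} {K : Type*} [TopologicalSpace K] :
    Continuous fun q : ((ℕ → X) × K) × (ℕ → X) => ((glue q.2 q.1.1, q.1.2) : (ℤ → X) × K) :=
  (continuous_glue.comp (continuous_snd.prodMk (continuous_fst.comp continuous_fst))).prodMk
    (continuous_snd.comp continuous_fst)

theorem continuous_glue_left {X : Set ℕ} {K : Type*} [TopologicalSpace K] (x : ℕ → X) :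
    Continuous fun p : (ℕ → X) × K => ((glue p.1 x, p.2) : (ℤ → X) × K) :=
  (continuous_glue.comp (continuous_fst.prodMk continuous_const)).prodMk continuous_snd

theorem abs_integral_le_of_forall {Ω : Type*} [MeasurableSpace Ω] {ν : Measure Ω}
    [IsProbabilityMeasure ν] {ψ : Ω → ℝ} {c : ℝ} (hc : ∀ z, |ψ z| ≤ c) : |∫ z, ψ z ∂ν| ≤ c := by
  have := norm_integral_le_of_norm_le_const (μ := ν) (f := ψ) (C := c) (ae_of_all _ hc)
  simpa using this

/-- The integral of a function on `K × Grass l d` over the fibres above a given future, as a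
function of the past and of the point of `K`. -/
noncomputable def fibreIntegral {X : Set ℕ} {K : Type*} [MeasurableSpace K] {l d : ℕ}
    (κ : Kernel ((ℤ → X) × K) (Grass l d)) (ψ : K × Grass l d → ℝ) (x : ℕ → X)
    (p : (ℕ → X) × K) : ℝ :=
  ∫ V, ψ (p.2, V) ∂(κ (glue p.1 x, p.2))

theorem abs_fibreIntegral_le {X : Set ℕ} {K : Type*} [MeasurableSpace K] {l d : ℕ}
    (κ : Kernel ((ℤ → X) × K) (Grass l d)) [IsMarkovKernel κ] {ψ : K × Grass l d → ℝ} {c : ℝ}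
    (hc : ∀ z, |ψ z| ≤ c) (x : ℕ → X) (p : (ℕ → X) × K) : |fibreIntegral κ ψ x p| ≤ c :=
  abs_integral_le_of_forall fun _ => hc _

theorem measurable_fibreIntegral {X : Set ℕ} {K : Type*} [MetricSpace K] [CompactSpace K]
    [MeasurableSpace K] [BorelSpace K] {l d : ℕ} (κ : Kernel ((ℤ → X) × K) (Grass l d))
    [IsMarkovKernel κ] {ψ : K × Grass l d → ℝ} (hψ : Continuous ψ) (x : ℕ → X) :
    Measurable (fibreIntegral κ ψ x) := by
  have : StronglyMeasurable fun q : ((ℕ → X) × K) × Grass l d => ψ (q.1.2, q.2) :=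
    Continuous.stronglyMeasurable (by fun_prop)
  have h := this.integral_kernel_prod_right'
    (κ := κ.comap (fun p : (ℕ → X) × K => (glue p.1 x, p.2)) (continuous_glue_left x).measurable)
  exact h.measurable

end UStates

/-! ### Fibre integrals of a u-state over nearby futures -/

namespace UStates

open scoped NNReal ENNReal

variable {X : Set ℕ} {n : ℕ} {K : Type*} [MetricSpace K] [CompactSpace K]
  [MeasurableSpace K] [BorelSpace K]
  [ChartedSpace (EuclideanSpace ℝ (Fin n)) K] [IsManifold (𝓡 n) ∞ K]
  [RiemannianBundle (fun t : K => TangentSpace (𝓡 n) t)] [IsRiemannianManifold (𝓡 n) K]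
  {F : SkewProduct X n K} {l d : ℕ}

/-- The futures above which the set `S` has full measure. -/
def fullFutures (μ : PartialProduct X K) (S : Set ((ℤ → X) × K)) : Set (ℕ → X) :=
  {x | ∀ᵐ p ∂(μ.μs.prod μ.μc), (glue p.1 x, p.2) ∈ S}

theorem abs_integral_sub_le_of_eq_map {ν ν' : Measure (Grass l d)} [IsProbabilityMeasure ν]
    [IsProbabilityMeasure ν'] {T : Grass l d → Grass l d} (h : ν' = ν.map T)
    {φ φ' : Grass l d → ℝ} (hφ : Continuous φ) (hφ' : Continuous φ') {ε : ℝ}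
    (hε : ∀ V, |φ' (T V) - φ V| ≤ ε) : |∫ V, φ' V ∂ν' - ∫ V, φ V ∂ν| ≤ ε := by
  -- Measurability of T comes for free: otherwise the pushforward would be zero by convention, and
  -- not a probability.
  have hT : AEMeasurable T ν := by
    by_contra hT
    rw [Measure.map_of_not_aemeasurable hT] at h
    exact IsProbabilityMeasure.ne_zero ν' h
  have hbd : ∀ g : Grass l d → ℝ, Continuous g → ∃ c, ∀ V, ‖g V‖ ≤ c := fun g hg => by
    obtain ⟨c, hc⟩ := isCompact_univ.exists_bound_of_continuousOn hg.continuousOn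
    exact ⟨c, fun V => hc V trivial⟩
  obtain ⟨c, hc⟩ := hbd φ hφ
  obtain ⟨c', hc'⟩ := hbd φ' hφ'
  have i1 : Integrable (fun V => φ' (T V)) ν :=
    Integrable.of_bound (hφ'.measurable.comp_aemeasurable hT).aestronglyMeasurable c'
      (ae_of_all _ fun V => hc' _)
  rw [h, integral_map hT hφ'.measurable.aestronglyMeasurable, ← integral_sub i1
    (Integrable.of_bound hφ.measurable.aestronglyMeasurable c (ae_of_all _ hc))]
  exact abs_integral_le_of_forall hε

/-- Fibre integrals over nearby futures almost coincide along strong-unstable holonomies. -/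
theorem exists_abs_fibreIntegral_hol_sub_le (hF : F.MostlyNeutral) (μ : PartialProduct X K)
    (hμ : MeasurePreserving F.map μ.measure μ.measure) {α : ℝ} (hα : 0 < α)
    {A : (ℤ → X) × K → (EuclideanSpace ℂ (Fin d) ≃L[ℂ] EuclideanSpace ℂ (Fin d))}
    {H : (ℤ → X) × K → (ℤ → X) × K → (EuclideanSpace ℂ (Fin d) ≃L[ℂ] EuclideanSpace ℂ (Fin d))}
    (hH : IsUnstableHolonomy F α A H) {κ : Kernel ((ℤ → X) × K) (Grass l d)} [IsMarkovKernel κ]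
    {S : Set ((ℤ → X) × K)}
    (hS : ∀ b ∈ S, ∀ q ∈ S, F.Wuu b q → κ q = (κ b).map (Grass.map (H b q)))
    {ψ : K × Grass l d → ℝ} (hψ : Continuous ψ) {ε : ℝ} (hε : 0 < ε) :
    ∃ N : ℕ, ∀ x ∈ fullFutures μ S, ∀ y ∈ fullFutures μ S, (∀ k < N, x k = y k) →
      ∀ᵐ p ∂(μ.μs.prod μ.μc),
        |fibreIntegral κ ψ y (p.1, F.hol (glue p.1 x) (glue p.1 y) p.2) -
          fibreIntegral κ ψ x p| ≤ ε := by
  obtain ⟨η, h0, hη⟩ := SkewProduct.exists_dist_hol_le hF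
  obtain ⟨C, hC⟩ := SkewProduct.exists_map_hol_le hF μ hμ
  obtain ⟨Λ, hΛ, hHol⟩ := hH.holder
  obtain ⟨δ, hδ, hδψ⟩ := Metric.uniformContinuous_iff.1
    (CompactSpace.uniformContinuous_of_continuous hψ) ε hε
  set θ : ℕ → ℝ := fun N => 2 * (1 / 2) ^ N + η N with hθ
  have hθ0 : Tendsto θ atTop (𝓝 0) := by
    have := ((tendsto_pow_atTop_nhds_zero_of_lt_one (r := (1 / 2 : ℝ)) (by norm_num)
      (by norm_num)).const_mul 2).add h0
    rwa [mul_zero, add_zero] at this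
  have hΛ0 : Tendsto (fun N => Λ * θ N ^ α) atTop (𝓝 0) := by
    have := (hθ0.rpow_const (p := α) (Or.inr hα.le)).const_mul Λ
    rwa [Real.zero_rpow hα.ne', mul_zero] at this
  -- In order: agreement at position 0 for `Wuu`, displacement in K, the hypothesis of
  -- `Grass.dist_map_le`, and displacement in the Grassmannian with its constant 3.
  obtain ⟨N, hN1, hN2, hN3, hN4⟩ : ∃ N, 1 ≤ N ∧ η N < δ ∧ Λ * θ N ^ α ≤ 1 / 2 ∧
      Λ * θ N ^ α < δ / 3 := ((eventually_ge_atTop 1).and ((h0.eventually (gt_mem_nhds hδ)).and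
    ((hΛ0.eventually (ge_mem_nhds (by norm_num : (0 : ℝ) < 1 / 2))).and
      (hΛ0.eventually (gt_mem_nhds (by positivity)))))).exists
  refine ⟨N, fun x hx y hy hxy => ?_⟩
  have hm : Measurable fun p : (ℕ → X) × K => (p.1, F.hol (glue p.1 x) (glue p.1 y) p.2) :=
    measurable_fst.prodMk (SkewProduct.measurable_hol hF x y)
  -- Holonomy invariance needs both endpoints in S; the Jacobian bound pulls null sets above y back
  -- to null sets.
  have hy' : ∀ᵐ p ∂(μ.μs.prod μ.μc), (glue p.1 y, F.hol (glue p.1 x) (glue p.1 y) p.2) ∈ S :=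
    ae_of_ae_map hm.aemeasurable
      ((Measure.absolutelyContinuous_of_le_smul (hC x y)).ae_le hy)
  filter_upwards [hx, hy'] with p hpx hpy
  set s := F.hol (glue p.1 x) (glue p.1 y) p.2 with hs
  have hw : F.Wuu (glue p.1 x, p.2) (glue p.1 y, s) :=
    SkewProduct.wuu_hol hF (fun k hk => glue_eq_of_lt hxy p.1 (by omega)) p.2
  have hds : dist s p.2 ≤ η N := hη N x y hxy p.1 p.2
  have htot : totalDist (glue p.1 x, p.2) (glue p.1 y, s) ≤ θ N :=
    add_le_add (shiftDist_le fun k hk => glue_eq_of_lt hxy p.1 hk) (by rwa [dist_comm])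
  have hnorm : ‖(H (glue p.1 x, p.2) (glue p.1 y, s) :
      EuclideanSpace ℂ (Fin d) →L[ℂ] EuclideanSpace ℂ (Fin d)) -
        ContinuousLinearMap.id ℂ (EuclideanSpace ℂ (Fin d))‖ ≤ Λ * θ N ^ α := by
    refine (hHol _ _ hw).trans ?_
    gcongr
    exact add_nonneg (shiftDist_nonneg _ _) dist_nonneg
  refine abs_integral_sub_le_of_eq_map (hS _ hpx _ hpy hw) (by fun_prop) (by fun_prop) fun V => ?_
  refine (hδψ ?_).le
  rw [Prod.dist_eq]
  refine max_lt (hds.trans_lt hN2) ?_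
  refine (Grass.dist_map_le _ (hnorm.trans hN3) V).trans_lt ?_
  linarith

/-- The fibre integrals over the futures of full measure near `x₀` almost coincide in `L¹`. -/
theorem exists_integral_abs_fibreIntegral_sub_le (hF : F.MostlyNeutral) (μ : PartialProduct X K)
    (hμ : MeasurePreserving F.map μ.measure μ.measure) {α : ℝ} (hα : 0 < α)
    {A : (ℤ → X) × K → (EuclideanSpace ℂ (Fin d) ≃L[ℂ] EuclideanSpace ℂ (Fin d))}
    {H : (ℤ → X) × K → (ℤ → X) × K → (EuclideanSpace ℂ (Fin d) ≃L[ℂ] EuclideanSpace ℂ (Fin d))}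
    (hH : IsUnstableHolonomy F α A H) {κ : Kernel ((ℤ → X) × K) (Grass l d)} [IsMarkovKernel κ]
    {S : Set ((ℤ → X) × K)}
    (hS : ∀ b ∈ S, ∀ q ∈ S, F.Wuu b q → κ q = (κ b).map (Grass.map (H b q)))
    (hdense : Dense (fullFutures μ S))
    {ψ : K × Grass l d → ℝ} (hψ : Continuous ψ) (x₀ : ℕ → X) {ε : ℝ} (hε : 0 < ε) :
    ∃ (θ : (ℕ → X) × K → ℝ) (c : ℝ), Measurable θ ∧ (∀ p, |θ p| ≤ c) ∧
      ∀ᶠ x in 𝓝[fullFutures μ S] x₀,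
        ∫ p, |fibreIntegral κ ψ x p - θ p| ∂(μ.μs.prod μ.μc) ≤ ε := by
  obtain ⟨C, hC⟩ := SkewProduct.exists_map_hol_le hF μ hμ
  obtain ⟨N, hN⟩ := exists_abs_fibreIntegral_hol_sub_le hF μ hμ hα hH hS hψ
    (show 0 < ε / 3 by positivity)
  -- A fixed reference future is chosen in the dense set, since x₀ itself may lie outside it.
  obtain ⟨y, hy, hyD⟩ : ((fullFutures μ S) ∩ {y | ∀ k < N, y k = x₀ k}).Nonempty := by
    obtain ⟨U, hU, hUo, hxU⟩ := eventually_nhds_iff.1 (eventually_agree x₀ N)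
    obtain ⟨y, hyU, hyD⟩ := hdense.inter_open_nonempty U hUo ⟨x₀, hxU⟩
    exact ⟨y, hyD, hU y hyU⟩
  obtain ⟨c, hc⟩ : ∃ c, ∀ z, |ψ z| ≤ c := by
    obtain ⟨c, hc⟩ := isCompact_univ.exists_bound_of_continuousOn hψ.continuousOn
    exact ⟨c, fun z => hc z trivial⟩
  set ν := μ.μs.prod μ.μc
  have hGm : ∀ x, Measurable (fibreIntegral κ ψ x) := measurable_fibreIntegral κ hψ
  have hGi : ∀ x, Integrable (fibreIntegral κ ψ x) ν := fun x =>
    Integrable.of_bound (hGm x).aestronglyMeasurable c (ae_of_all _ (abs_fibreIntegral_le κ hc x))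
  obtain ⟨g, hg, hgi⟩ := (hGi y).exists_boundedContinuous_integral_sub_le
    (show 0 < ε / (3 * (C + 1)) by positivity)
  have hgb : ∀ p, |g p| ≤ ‖g‖ := g.norm_coe_le_norm
  have hgm : Measurable g := g.continuous.measurable
  set Φ : (ℕ → X) → (ℕ → X) × K → (ℕ → X) × K :=
    fun x p => (p.1, F.hol (glue p.1 x) (glue p.1 y) p.2) with hΦ
  have hΦm : ∀ x, Measurable (Φ x) := fun x =>
    measurable_fst.prodMk (SkewProduct.measurable_hol hF x y)
  have hgΦm : ∀ x, Measurable fun p => g (Φ x p) := fun x => hgm.comp (hΦm x)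
  have hgΦi : ∀ x, Integrable (fun p => g (Φ x p)) ν := fun x =>
    Integrable.of_bound (hgΦm x).aestronglyMeasurable ‖g‖ (ae_of_all _ fun p => hgb _)
  have hGΦi : ∀ x, Integrable (fun p => fibreIntegral κ ψ y (Φ x p)) ν := fun x =>
    Integrable.of_bound ((hGm y).comp (hΦm x)).aestronglyMeasurable c
      (ae_of_all _ fun p => abs_fibreIntegral_le κ hc y _)
  -- Here continuity of g is essential: the holonomy from x to y converges pointwise as x tends to
  -- x₀.
  have hlim : Tendsto (fun x => ∫ p, |g (Φ x p) - g (Φ x₀ p)| ∂ν) (𝓝 x₀) (𝓝 0) := by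
    have h := tendsto_integral_filter_of_dominated_convergence (μ := ν) (l := 𝓝 x₀)
      (F := fun x p => |g (Φ x p) - g (Φ x₀ p)|) (f := fun _ => 0) (fun _ => 2 * ‖g‖)
      (Eventually.of_forall fun x => ((hgΦm x).sub (hgΦm x₀)).abs.aestronglyMeasurable)
      (Eventually.of_forall fun x => ae_of_all _ fun p => ?_) (integrable_const _)
      (ae_of_all _ fun p => ?_)
    · simpa using h
    · rw [Real.norm_eq_abs, abs_abs]
      calc |g (Φ x p) - g (Φ x₀ p)| ≤ |g (Φ x p)| + |g (Φ x₀ p)| := abs_sub _ _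
        _ ≤ 2 * ‖g‖ := by linarith [hgb (Φ x p), hgb (Φ x₀ p)]
    · have h1 : Tendsto (fun x => g (Φ x p)) (𝓝 x₀) (𝓝 (g (Φ x₀ p))) :=
        (g.continuous.tendsto _).comp (tendsto_const_nhds.prodMk_nhds
          (SkewProduct.tendsto_hol_left hF p.1 x₀ y p.2))
      simpa using (h1.sub_const (g (Φ x₀ p))).abs
  refine ⟨fun p => g (Φ x₀ p), ‖g‖, hgΦm x₀, fun p => hgb _, ?_⟩
  filter_upwards [self_mem_nhdsWithin, nhdsWithin_le_nhds (eventually_agree x₀ N),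
    nhdsWithin_le_nhds (hlim.eventually (ge_mem_nhds (show 0 < ε / 3 by positivity)))]
    with x hxD hxN hxε
  have i1 : Integrable (fun p => |fibreIntegral κ ψ y (Φ x p) - fibreIntegral κ ψ x p|) ν :=
    ((hGΦi x).sub (hGi x)).abs
  have i2 : Integrable (fun p => |fibreIntegral κ ψ y (Φ x p) - g (Φ x p)|) ν :=
    ((hGΦi x).sub (hgΦi x)).abs
  have i3 : Integrable (fun p => |g (Φ x p) - g (Φ x₀ p)|) ν := ((hgΦi x).sub (hgΦi x₀)).abs
  have i12 : Integrable (fun p => |fibreIntegral κ ψ y (Φ x p) - fibreIntegral κ ψ x p| +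
      |fibreIntegral κ ψ y (Φ x p) - g (Φ x p)|) ν := i1.add i2
  have b1 : ∫ p, |fibreIntegral κ ψ y (Φ x p) - fibreIntegral κ ψ x p| ∂ν ≤ ε / 3 := by
    have h := integral_mono_ae i1 (integrable_const (ε / 3))
      (hN x hxD y hy fun k hk => (hxN k hk).trans (hyD k hk).symm)
    simpa using h
  have b2 : ∫ p, |fibreIntegral κ ψ y (Φ x p) - g (Φ x p)| ∂ν ≤ ε / 3 := by
    have hi : Integrable (fun p => |fibreIntegral κ ψ y p - g p|) ν := ((hGi y).sub hgi).abs
    have hm : AEStronglyMeasurable (fun p => |fibreIntegral κ ψ y p - g p|) (ν.map (Φ x)) :=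
      ((hGm y).sub hgm).abs.aestronglyMeasurable
    calc ∫ p, |fibreIntegral κ ψ y (Φ x p) - g (Φ x p)| ∂ν
        = ∫ p, |fibreIntegral κ ψ y p - g p| ∂(ν.map (Φ x)) :=
          (integral_map (hΦm x).aemeasurable hm).symm
      _ ≤ ∫ p, |fibreIntegral κ ψ y p - g p| ∂(C • ν) :=
          integral_mono_measure (hC x y) (ae_of_all _ fun p => abs_nonneg _)
            (hi.smul_measure_nnreal)
      _ = C * ∫ p, |fibreIntegral κ ψ y p - g p| ∂ν := integral_smul_nnreal_measure _ _
      _ ≤ (C + 1) * (ε / (3 * (C + 1))) := by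
          gcongr
          · linarith
          · simpa using hg
      _ = ε / 3 := by field_simp
  calc ∫ p, |fibreIntegral κ ψ x p - g (Φ x₀ p)| ∂ν
      ≤ ∫ p, (|fibreIntegral κ ψ y (Φ x p) - fibreIntegral κ ψ x p| +
          |fibreIntegral κ ψ y (Φ x p) - g (Φ x p)| + |g (Φ x p) - g (Φ x₀ p)|) ∂ν := by
        refine integral_mono ((hGi x).sub (hgΦi x₀)).abs (i12.add i3) fun p => ?_
        have e : fibreIntegral κ ψ x p - g (Φ x₀ p) =
            -(fibreIntegral κ ψ y (Φ x p) - fibreIntegral κ ψ x p) +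
            (fibreIntegral κ ψ y (Φ x p) - g (Φ x p)) + (g (Φ x p) - g (Φ x₀ p)) := by ring
        simp only [e]
        refine (abs_add_three _ _ _).trans_eq ?_
        rw [abs_neg]
    _ = ∫ p, |fibreIntegral κ ψ y (Φ x p) - fibreIntegral κ ψ x p| ∂ν +
          ∫ p, |fibreIntegral κ ψ y (Φ x p) - g (Φ x p)| ∂ν +
          ∫ p, |g (Φ x p) - g (Φ x₀ p)| ∂ν := by rw [integral_add i12 i3, integral_add i1 i2]
    _ ≤ ε / 3 + ε / 3 + ε / 3 := by gcongr
    _ = ε := by ring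

end UStates

/-! ### Averages over the pasts -/

namespace UStates

open scoped NNReal ENNReal

namespace PartialProduct

theorem continuous_ρ_glue {X : Set ℕ} {K : Type*} [TopologicalSpace K] [MeasurableSpace K]
    (μ : PartialProduct X K) :
    Continuous fun q : ((ℕ → X) × K) × (ℕ → X) => μ.ρ (glue q.2 q.1.1, q.1.2) :=
  μ.continuous_ρ.comp continuous_glue_prod

theorem continuous_ρ_glue_right {X : Set ℕ} {K : Type*} [TopologicalSpace K] [MeasurableSpace K]
    (μ : PartialProduct X K) (q : (ℕ → X) × K) :
    Continuous fun xs : ℕ → X => μ.ρ (glue xs q.1, q.2) :=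
  μ.continuous_ρ_glue.comp (continuous_const.prodMk continuous_id)

variable {X : Set ℕ} {K : Type*} [MetricSpace K] [MeasurableSpace K] [BorelSpace K]

theorem integrable_ρ_glue (μ : PartialProduct X K) (q : (ℕ → X) × K) :
    Integrable (fun xs => μ.ρ (glue xs q.1, q.2)) μ.μs := by
  obtain ⟨a, b, -, hab, -⟩ := μ.exists_bounds
  refine Integrable.of_bound (μ.continuous_ρ_glue_right q).measurable.aestronglyMeasurable b
    (ae_of_all _ fun xs => ?_)
  rw [Real.norm_of_nonneg (a.2.trans (hab _).1)]
  exact (hab _).2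

theorem ρu_mem (μ : PartialProduct X K) {a b : ℝ≥0} (hab : ∀ p, a ≤ μ.ρ p ∧ μ.ρ p ≤ b)
    (q : (ℕ → X) × K) : a ≤ μ.ρu q.1 q.2 ∧ μ.ρu q.1 q.2 ≤ b := by
  constructor
  · have := integral_mono (integrable_const (a : ℝ)) (μ.integrable_ρ_glue q) fun xs => (hab _).1
    simpa [ρu] using this
  · have := integral_mono (μ.integrable_ρ_glue q) (integrable_const (b : ℝ)) fun xs => (hab _).2
    simpa [ρu] using this

theorem ρu_pos (μ : PartialProduct X K) (q : (ℕ → X) × K) : 0 < μ.ρu q.1 q.2 := by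
  obtain ⟨a, b, ha, hab, -⟩ := μ.exists_bounds
  exact lt_of_lt_of_le (by exact_mod_cast ha) (μ.ρu_mem hab q).1

theorem continuous_ρu (μ : PartialProduct X K) :
    Continuous fun q : (ℕ → X) × K => μ.ρu q.1 q.2 := by
  obtain ⟨a, b, -, hab, -⟩ := μ.exists_bounds
  refine continuous_of_dominated (F := fun (q : (ℕ → X) × K) xs => μ.ρ (glue xs q.1, q.2))
    (bound := fun _ => (b : ℝ))
    (fun q => (μ.continuous_ρ_glue_right q).measurable.aestronglyMeasurable)
    (fun q => ae_of_all _ fun xs => ?_) (integrable_const _) (ae_of_all _ fun xs => ?_)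
  · rw [Real.norm_of_nonneg (a.2.trans (hab _).1)]
    exact (hab _).2
  · exact μ.continuous_ρ_glue.comp (continuous_id.prodMk continuous_const)

theorem lintegral_ρ_glue (μ : PartialProduct X K) (q : (ℕ → X) × K) :
    ∫⁻ xs, ENNReal.ofReal (μ.ρ (glue xs q.1, q.2)) ∂μ.μs = ENNReal.ofReal (μ.ρu q.1 q.2) := by
  obtain ⟨a, b, -, hab, -⟩ := μ.exists_bounds
  exact (ofReal_integral_eq_lintegral_ofReal (μ.integrable_ρ_glue q)
    (ae_of_all _ fun xs => a.2.trans (hab _).1)).symm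

theorem lintegral_measure (μ : PartialProduct X K) {g : (ℤ → X) × K → ℝ≥0∞} (hg : Measurable g) :
    ∫⁻ p, g p ∂μ.measure = ∫⁻ q, ∫⁻ xs, ENNReal.ofReal (μ.ρ (glue xs q.1, q.2)) *
      g (glue xs q.1, q.2) ∂μ.μs ∂(μ.μu.prod μ.μc) := by
  have hρ : Measurable fun p => ENNReal.ofReal (μ.ρ p) := μ.continuous_ρ.measurable.ennreal_ofReal
  have hglue : Measurable fun p : ((ℕ → X) × (ℕ → X)) × K =>
      ((glue p.1.1 p.1.2, p.2) : (ℤ → X) × K) :=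
    ((continuous_glue.comp continuous_fst).prodMk continuous_snd).measurable
  have hglue' : Measurable fun z : (ℕ → X) × (ℕ → X) × K =>
      ((glue z.1 z.2.1, z.2.2) : (ℤ → X) × K) :=
    (continuous_glue_prod.comp (continuous_snd.prodMk continuous_fst)).measurable
  rw [measure, lintegral_withDensity_eq_lintegral_mul _ hρ hg, lintegral_map (hρ.mul hg) hglue]
  have h := (measurePreserving_prodAssoc μ.μs μ.μu μ.μc).lintegral_comp
    ((hρ.mul hg).comp hglue')
  refine h.trans ?_
  rw [lintegral_prod_symm _ ((hρ.mul hg).comp hglue').aemeasurable]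
  rfl

/-- The density is bounded from zero, so null sets of the measure are null for the product; Fubini
with the future as outer variable concludes. -/
theorem ae_mem_fullFutures (μ : PartialProduct X K) {S : Set ((ℤ → X) × K)}
    (hS : μ.measure Sᶜ = 0) : ∀ᵐ x ∂μ.μu, x ∈ fullFutures μ S := by
  obtain ⟨a, b, ha, hab, -⟩ := μ.exists_bounds
  have hρ : Measurable fun p => ENNReal.ofReal (μ.ρ p) := μ.continuous_ρ.measurable.ennreal_ofReal
  have hglue : Measurable fun p : ((ℕ → X) × (ℕ → X)) × K =>
      ((glue p.1.1 p.1.2, p.2) : (ℤ → X) × K) :=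
    ((continuous_glue.comp continuous_fst).prodMk continuous_snd).measurable
  have h1 : ∀ᵐ p ∂μ.measure, p ∈ S := hS
  have h2 := (withDensity_absolutelyContinuous' hρ.aemeasurable (ae_of_all _ fun p =>
    (ENNReal.ofReal_pos.2 (lt_of_lt_of_le (by exact_mod_cast ha) (hab p).1)).ne')).ae_le h1
  have h3 := ae_of_ae_map hglue.aemeasurable h2
  have hmp : MeasurePreserving (fun z : (ℕ → X) × (ℕ → X) × K => ((z.2.1, z.1), z.2.2))
      (μ.μu.prod (μ.μs.prod μ.μc)) ((μ.μs.prod μ.μu).prod μ.μc) :=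
    ((Measure.measurePreserving_swap (μ := μ.μu) (ν := μ.μs)).prod (MeasurePreserving.id μ.μc)).comp
      ((measurePreserving_prodAssoc μ.μu μ.μs μ.μc).symm _)
  exact Measure.ae_ae_of_ae_prod (hmp.quasiMeasurePreserving.ae h3)

theorem dense_fullFutures (μ : PartialProduct X K) {S : Set ((ℤ → X) × K)}
    (hS : μ.measure Sᶜ = 0) : Dense (fullFutures μ S) :=
  Measure.dense_of_ae (μ.ae_mem_fullFutures hS)

variable {l d : ℕ}

/-- The average over the pasts of a family of measures on the Grassmannian. -/
noncomputable def avg (μ : PartialProduct X K) (κ : Kernel ((ℤ → X) × K) (Grass l d))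
    (q : (ℕ → X) × K) : Measure (Grass l d) :=
  (ENNReal.ofReal (μ.ρu q.1 q.2))⁻¹ •
    (μ.μs.withDensity (fun xs => ENNReal.ofReal (μ.ρ (glue xs q.1, q.2)))).bind
      (fun xs => κ (glue xs q.1, q.2))

theorem measurable_kernel_glue (κ : Kernel ((ℤ → X) × K) (Grass l d)) (q : (ℕ → X) × K) :
    Measurable fun xs : ℕ → X => κ (glue xs q.1, q.2) :=
  κ.measurable.comp (continuous_glue_prod.comp (continuous_const.prodMk continuous_id)).measurable

theorem avg_apply (μ : PartialProduct X K) (κ : Kernel ((ℤ → X) × K) (Grass l d))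
    (q : (ℕ → X) × K) {s : Set (Grass l d)} (hs : MeasurableSet s) :
    μ.avg κ q s = (ENNReal.ofReal (μ.ρu q.1 q.2))⁻¹ *
      ∫⁻ xs, ENNReal.ofReal (μ.ρ (glue xs q.1, q.2)) * κ (glue xs q.1, q.2) s ∂μ.μs := by
  have hκ : Measurable fun xs : ℕ → X => κ (glue xs q.1, q.2) s :=
    (Measure.measurable_coe hs).comp (measurable_kernel_glue κ q)
  rw [avg, Measure.smul_apply, smul_eq_mul,
    Measure.bind_apply hs (measurable_kernel_glue κ q).aemeasurable,
    lintegral_withDensity_eq_lintegral_mul _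
      (μ.continuous_ρ_glue_right q).measurable.ennreal_ofReal hκ]
  rfl

/-- The average over the pasts as a kernel. -/
noncomputable def avgKernel (μ : PartialProduct X K) (κ : Kernel ((ℤ → X) × K) (Grass l d)) :
    Kernel ((ℕ → X) × K) (Grass l d) where
  toFun := μ.avg κ
  measurable' := by
    refine Measure.measurable_of_measurable_coe _ fun s hs => ?_
    simp only [avg_apply μ κ _ hs]
    refine μ.continuous_ρu.measurable.ennreal_ofReal.inv.mul (Measurable.lintegral_prod_right'
      (f := fun z : ((ℕ → X) × K) × (ℕ → X) => ENNReal.ofReal (μ.ρ (glue z.2 z.1.1, z.1.2)) *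
        κ (glue z.2 z.1.1, z.1.2) s) ?_)
    exact μ.continuous_ρ_glue.measurable.ennreal_ofReal.mul
      ((κ.measurable_coe hs).comp continuous_glue_prod.measurable)

theorem avgKernel_apply (μ : PartialProduct X K) (κ : Kernel ((ℤ → X) × K) (Grass l d))
    (q : (ℕ → X) × K) : μ.avgKernel κ q = μ.avg κ q := rfl

instance (μ : PartialProduct X K) (κ : Kernel ((ℤ → X) × K) (Grass l d)) [IsMarkovKernel κ] :
    IsMarkovKernel (μ.avgKernel κ) := by
  refine ⟨fun q => ⟨?_⟩⟩
  rw [avgKernel_apply, avg_apply _ _ _ MeasurableSet.univ]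
  simp only [measure_univ, mul_one]
  rw [lintegral_ρ_glue, ENNReal.inv_mul_cancel (ENNReal.ofReal_pos.2 (μ.ρu_pos q)).ne'
    ENNReal.ofReal_ne_top]

theorem integral_avg (μ : PartialProduct X K) (κ : Kernel ((ℤ → X) × K) (Grass l d))
    [IsMarkovKernel κ] (q : (ℕ → X) × K) {φ : Grass l d → ℝ} (hφ : Continuous φ) :
    ∫ V, φ V ∂(μ.avg κ q) = ∫ xs, μ.ρ (glue xs q.1, q.2) / μ.ρu q.1 q.2 *
      ∫ V, φ V ∂(κ (glue xs q.1, q.2)) ∂μ.μs := by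
  obtain ⟨a, b, -, hab, -⟩ := μ.exists_bounds
  obtain ⟨c, hc⟩ := isCompact_univ.exists_bound_of_continuousOn hφ.continuousOn
  have hm : Measurable fun xs : ℕ → X => ((glue xs q.1, q.2) : (ℤ → X) × K) :=
    (continuous_glue_prod.comp (continuous_const.prodMk continuous_id)).measurable
  have hρ := (μ.continuous_ρ_glue_right q).measurable
  set w := μ.μs.withDensity (fun xs => ENNReal.ofReal (μ.ρ (glue xs q.1, q.2)))
  have : IsFiniteMeasure w := isFiniteMeasure_withDensity_ofReal (μ.integrable_ρ_glue q).2
  have hint : Integrable φ ((κ.comap _ hm) ∘ₘ w) :=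
    Integrable.of_bound hφ.measurable.aestronglyMeasurable c (ae_of_all _ fun V => hc V trivial)
  have h1 : ∫ V, φ V ∂(w.bind fun xs => κ (glue xs q.1, q.2)) =
      ∫ xs, ∫ V, φ V ∂(κ (glue xs q.1, q.2)) ∂w :=
    Kernel.integral_comp (η := κ.comap _ hm) (κ := Kernel.const Unit w) (a := ()) hint
  rw [avg, integral_smul_measure, h1, integral_withDensity_eq_integral_toReal_smul
    hρ.ennreal_ofReal (ae_of_all _ fun _ => ENNReal.ofReal_lt_top), smul_eq_mul,
    ← integral_const_mul]
  refine integral_congr_ae (ae_of_all _ fun xs => ?_)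
  simp only [smul_eq_mul]
  rw [ENNReal.toReal_inv, ENNReal.toReal_ofReal (μ.ρu_pos q).le,
    ENNReal.toReal_ofReal (a.2.trans (hab _).1)]
  ring

/-- The projection of the measure to the one-sided space. -/
noncomputable def oneSided (μ : PartialProduct X K) : Measure ((ℕ → X) × K) :=
  μ.measure.map fun p => (future p.1, p.2)

theorem measurable_future_prod : Measurable fun p : (ℤ → X) × K => (future p.1, p.2) :=
  ((continuous_future.comp continuous_fst).prodMk continuous_snd).measurable

instance (μ : PartialProduct X K) : IsProbabilityMeasure μ.oneSided :=
  Measure.isProbabilityMeasure_map measurable_future_prod.aemeasurable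

theorem lintegral_oneSided (μ : PartialProduct X K) {g : (ℕ → X) × K → ℝ≥0∞} (hg : Measurable g) :
    ∫⁻ q, g q ∂μ.oneSided = ∫⁻ q, ENNReal.ofReal (μ.ρu q.1 q.2) * g q ∂(μ.μu.prod μ.μc) := by
  have hg' : Measurable fun p : (ℤ → X) × K => g (future p.1, p.2) := hg.comp measurable_future_prod
  rw [oneSided, lintegral_map hg measurable_future_prod, μ.lintegral_measure hg']
  refine lintegral_congr fun q => ?_
  simp only [future_glue]
  rw [lintegral_mul_const _ (μ.continuous_ρ_glue_right q).measurable.ennreal_ofReal,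
    lintegral_ρ_glue]

theorem oneSided_absolutelyContinuous (μ : PartialProduct X K) : μ.oneSided ≪ μ.μu.prod μ.μc := by
  refine Measure.AbsolutelyContinuous.mk fun s hs h0 => ?_
  rw [← lintegral_indicator_one hs, lintegral_oneSided _ (measurable_one.indicator hs)]
  have : ∀ᵐ q ∂(μ.μu.prod μ.μc), q ∉ s := measure_eq_zero_iff_ae_notMem.1 h0
  refine (lintegral_congr_ae ?_).trans lintegral_zero
  filter_upwards [this] with q hq
  rw [Set.indicator_of_notMem hq, mul_zero]

/-- The density `ρu` of the projected measure cancels the normalization of the average, leaving the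
same integral over the pasts on both sides. -/
theorem oneSided_compProd_avgKernel (μ : PartialProduct X K)
    (κ : Kernel ((ℤ → X) × K) (Grass l d)) [IsMarkovKernel κ] :
    μ.oneSided ⊗ₘ μ.avgKernel κ =
      (μ.measure ⊗ₘ κ).map fun z => ((future z.1.1, z.1.2), z.2) := by
  have hm : Measurable fun z : ((ℤ → X) × K) × Grass l d => ((future z.1.1, z.1.2), z.2) :=
    (measurable_future_prod.comp measurable_fst).prodMk measurable_snd
  ext s hs
  rw [Measure.map_apply hm hs, Measure.compProd_apply hs, Measure.compProd_apply (hm hs),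
    lintegral_oneSided _ (Kernel.measurable_kernel_prodMk_left hs),
    lintegral_measure _ (Kernel.measurable_kernel_prodMk_left (hm hs))]
  refine lintegral_congr fun q => ?_
  rw [avgKernel_apply, avg_apply _ _ _ (measurable_prodMk_left hs), ← mul_assoc,
    ENNReal.mul_inv_cancel (ENNReal.ofReal_pos.2 (μ.ρu_pos q)).ne' ENNReal.ofReal_ne_top, one_mul]
  rfl

end PartialProduct

variable {X : Set ℕ} {n : ℕ} {K : Type*} [MetricSpace K] [CompactSpace K]
  [MeasurableSpace K] [BorelSpace K]
  [ChartedSpace (EuclideanSpace ℝ (Fin n)) K] [IsManifold (𝓡 n) ∞ K]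
  [RiemannianBundle (fun t : K => TangentSpace (𝓡 n) t)] [IsRiemannianManifold (𝓡 n) K]
  {F : SkewProduct X n K} {l d : ℕ}

/-- The averages over the pasts, above the futures of full measure near `x₀`, almost coincide
in `L¹`. -/
theorem exists_integral_abs_avg_sub_le (hF : F.MostlyNeutral) (μ : PartialProduct X K)
    (hμ : MeasurePreserving F.map μ.measure μ.measure) {α : ℝ} (hα : 0 < α)
    {A : (ℤ → X) × K → (EuclideanSpace ℂ (Fin d) ≃L[ℂ] EuclideanSpace ℂ (Fin d))}
    {H : (ℤ → X) × K → (ℤ → X) × K → (EuclideanSpace ℂ (Fin d) ≃L[ℂ] EuclideanSpace ℂ (Fin d))}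
    (hH : IsUnstableHolonomy F α A H) {κ : Kernel ((ℤ → X) × K) (Grass l d)} [IsMarkovKernel κ]
    {S : Set ((ℤ → X) × K)}
    (hS : ∀ b ∈ S, ∀ q ∈ S, F.Wuu b q → κ q = (κ b).map (Grass.map (H b q)))
    (hdense : Dense (fullFutures μ S))
    {ψ : K × Grass l d → ℝ} (hψ : Continuous ψ) (x₀ : ℕ → X) {ε : ℝ} (hε : 0 < ε) :
    ∃ v : K → ℝ, Integrable v μ.μc ∧ ∀ᶠ x in 𝓝[fullFutures μ S] x₀,
        ∫ t, |∫ V, ψ (t, V) ∂(μ.avg κ (x, t)) - v t| ∂μ.μc ≤ ε := by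
  obtain ⟨a, b, ha, hab, -⟩ := μ.exists_bounds
  have ha' : (0 : ℝ) < a := by exact_mod_cast ha
  obtain ⟨c₀, hc₀⟩ : ∃ c, ∀ z, |ψ z| ≤ c := by
    obtain ⟨c, hc⟩ := isCompact_univ.exists_bound_of_continuousOn hψ.continuousOn
    exact ⟨c, fun z => hc z trivial⟩
  set R : ℝ := b / a
  have hR : 0 ≤ R := by positivity
  set r : (ℕ → X) → (ℕ → X) × K → ℝ := fun x p => μ.ρ (glue p.1 x, p.2) / μ.ρu x p.2 with hr
  have hρ0 : ∀ p, 0 ≤ μ.ρ p := fun p => a.2.trans (hab p).1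
  have hr0 : ∀ x p, 0 ≤ r x p := fun x p => div_nonneg (hρ0 _) (μ.ρu_pos (x, p.2)).le
  have hrR : ∀ x p, r x p ≤ R := fun x p =>
    div_le_div₀ b.2 (hab _).2 ha' (μ.ρu_mem hab (x, p.2)).1
  have hrabs : ∀ x p, |r x p| ≤ R := fun x p => by rw [abs_of_nonneg (hr0 x p)]; exact hrR x p
  have hrx : ∀ p, Continuous fun x => r x p := fun p => by
    refine Continuous.div ?_ ?_ fun x => (μ.ρu_pos (x, p.2)).ne'
    · exact μ.continuous_ρ_glue.comp ((continuous_id.prodMk continuous_const).prodMk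
        continuous_const)
    · exact μ.continuous_ρu.comp (continuous_id.prodMk continuous_const)
  have hrp : ∀ x, Measurable (r x) := fun x => by
    refine (Continuous.div ?_ ?_ fun p : (ℕ → X) × K => (μ.ρu_pos (x, p.2)).ne').measurable
    · exact μ.continuous_ρ_glue.comp ((continuous_const.prodMk continuous_snd).prodMk
        continuous_fst)
    · exact μ.continuous_ρu.comp (continuous_const.prodMk continuous_snd)
  obtain ⟨θ, c, hθm, hθc, hθ⟩ := exists_integral_abs_fibreIntegral_sub_le hF μ hμ hα hH hS hdense
    hψ x₀ (show 0 < ε / (2 * (R + 1)) by positivity)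
  set ν := μ.μs.prod μ.μc with hν
  have hGm := measurable_fibreIntegral κ hψ
  have hGc := abs_fibreIntegral_le κ hc₀
  have bdi : ∀ {g : (ℕ → X) × K → ℝ} {C : ℝ}, Measurable g → (∀ p, |g p| ≤ C) → Integrable g ν :=
    fun hg hC => Integrable.of_bound hg.aestronglyMeasurable _ (ae_of_all _ hC)
  have mulb : ∀ {u v C C' : ℝ}, |u| ≤ C → |v| ≤ C' → |u * v| ≤ C * C' := fun hu hv => by
    rw [abs_mul]; exact mul_le_mul hu hv (abs_nonneg _) ((abs_nonneg _).trans hu)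
  have hrGi : ∀ x, Integrable (fun p => r x p * fibreIntegral κ ψ x p) ν := fun x =>
    bdi ((hrp x).mul (hGm x)) fun p => mulb (hrabs x p) (hGc x p)
  have hrθi : Integrable (fun p => r x₀ p * θ p) ν :=
    bdi ((hrp x₀).mul hθm) fun p => mulb (hrabs x₀ p) (hθc p)
  have hlim : Tendsto (fun x => c * ∫ p, |r x p - r x₀ p| ∂ν) (𝓝 x₀) (𝓝 0) := by
    have h := tendsto_integral_filter_of_dominated_convergence (μ := ν) (l := 𝓝 x₀)
      (F := fun x p => |r x p - r x₀ p|) (f := fun _ => 0) (fun _ => R + R)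
      (Eventually.of_forall fun x => ((hrp x).sub (hrp x₀)).abs.aestronglyMeasurable)
      (Eventually.of_forall fun x => ae_of_all _ fun p => ?_) (integrable_const _)
      (ae_of_all _ fun p => ?_)
    · simpa using h.const_mul c
    · rw [Real.norm_eq_abs, abs_abs]
      exact (abs_sub _ _).trans (add_le_add (hrabs x p) (hrabs x₀ p))
    · simpa using (((hrx p).tendsto x₀).sub_const (r x₀ p)).abs
  have hu : ∀ x t, ∫ V, ψ (t, V) ∂(μ.avg κ (x, t)) =
      ∫ xs, r x (xs, t) * fibreIntegral κ ψ x (xs, t) ∂μ.μs := fun x t =>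
    μ.integral_avg κ (x, t) (φ := fun V => ψ (t, V)) (by fun_prop)
  -- The normalized density r is bounded and continuous in x, so it may be frozen at x₀ together
  -- with θ.
  refine ⟨fun t => ∫ xs, r x₀ (xs, t) * θ (xs, t) ∂μ.μs, hrθi.integral_prod_right, ?_⟩
  filter_upwards [hθ, nhdsWithin_le_nhds (hlim.eventually (ge_mem_nhds (half_pos hε)))]
    with x hx hxr
  have hdi : Integrable (fun p => r x p * fibreIntegral κ ψ x p - r x₀ p * θ p) ν :=
    (hrGi x).sub hrθi
  have hi1 : Integrable (fun p => |fibreIntegral κ ψ x p - θ p|) ν :=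
    ((bdi (hGm x) (hGc x)).sub (bdi hθm hθc)).abs
  have hi2 : Integrable (fun p => |r x p - r x₀ p|) ν :=
    ((bdi (hrp x) (hrabs x)).sub (bdi (hrp x₀) (hrabs x₀))).abs
  have hslice : ∀ {g : (ℕ → X) × K → ℝ} {C : ℝ}, Measurable g → (∀ p, |g p| ≤ C) → ∀ t,
      Integrable (fun xs => g (xs, t)) μ.μs := fun hg hC t =>
    Integrable.of_bound (hg.comp measurable_prodMk_right).aestronglyMeasurable _
      (ae_of_all _ fun xs => hC _)
  calc ∫ t, |∫ V, ψ (t, V) ∂(μ.avg κ (x, t)) - ∫ xs, r x₀ (xs, t) * θ (xs, t) ∂μ.μs| ∂μ.μc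
      ≤ ∫ t, ∫ xs, |r x (xs, t) * fibreIntegral κ ψ x (xs, t) - r x₀ (xs, t) * θ (xs, t)| ∂μ.μs
          ∂μ.μc := by
        refine integral_mono ?_ hdi.abs.integral_prod_right fun t => ?_
        · simp only [hu]
          exact ((hrGi x).integral_prod_right.sub hrθi.integral_prod_right).abs
        · simp only [hu]
          have j1 : Integrable (fun xs => r x (xs, t) * fibreIntegral κ ψ x (xs, t)) μ.μs :=
            hslice ((hrp x).mul (hGm x)) (fun p => mulb (hrabs x p) (hGc x p)) t
          have j2 : Integrable (fun xs => r x₀ (xs, t) * θ (xs, t)) μ.μs :=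
            hslice ((hrp x₀).mul hθm) (fun p => mulb (hrabs x₀ p) (hθc p)) t
          rw [← integral_sub j1 j2]
          exact abs_integral_le_integral_abs
    _ = ∫ p, |r x p * fibreIntegral κ ψ x p - r x₀ p * θ p| ∂ν :=
        (integral_prod_symm _ hdi.abs).symm
    _ ≤ ∫ p, (R * |fibreIntegral κ ψ x p - θ p| + c * |r x p - r x₀ p|) ∂ν := by
        refine integral_mono hdi.abs ((hi1.const_mul R).add (hi2.const_mul c)) fun p => ?_
        have e : r x p * fibreIntegral κ ψ x p - r x₀ p * θ p =
            r x p * (fibreIntegral κ ψ x p - θ p) + θ p * (r x p - r x₀ p) := by ring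
        simp only [e]
        refine (abs_add_le _ _).trans ?_
        rw [abs_mul, abs_mul, abs_of_nonneg (hr0 x p)]
        gcongr
        · exact hrR x p
        · exact hθc p
    _ = R * ∫ p, |fibreIntegral κ ψ x p - θ p| ∂ν + c * ∫ p, |r x p - r x₀ p| ∂ν := by
        rw [integral_add (hi1.const_mul R) (hi2.const_mul c), integral_const_mul,
          integral_const_mul]
    _ ≤ (R + 1) * (ε / (2 * (R + 1))) + ε / 2 := by
        gcongr
        linarith
    _ = ε := by field_simp; ring

end UStates

/-! ### Extension from a dense set of futures -/

namespace UStates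

open scoped NNReal ENNReal

section Extension

/-- Closed sets form a generating π-system, and the measure of a closed set is a limit of integrals
of continuous functions, each continuous in z. A weak* continuous family is thus a kernel. -/
theorem measurable_of_continuous_probabilityMeasure {Z Ω : Type*} [TopologicalSpace Z]
    [MeasurableSpace Z] [OpensMeasurableSpace Z] [TopologicalSpace Ω] [HasOuterApproxClosed Ω]
    [MeasurableSpace Ω] [BorelSpace Ω] {P : Z → ProbabilityMeasure Ω} (hP : Continuous P) :
    Measurable fun z => (P z : Measure Ω) := by
  refine Measurable.measure_of_isPiSystem_of_isProbabilityMeasure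
    (BorelSpace.measurable_eq.trans borel_eq_generateFrom_isClosed) isPiSystem_isClosed
    fun G hG => ?_
  refine ENNReal.measurable_of_tendsto (f := fun n z => ∫⁻ w, (hG.apprSeq n w : ℝ≥0∞) ∂(P z))
    (fun n => ?_) (tendsto_pi_nhds.2 fun z =>
      HasOuterApproxClosed.tendsto_lintegral_apprSeq hG (P z : Measure Ω))
  refine Continuous.measurable (continuous_iff_continuousAt.2 fun z => ?_)
  exact (ProbabilityMeasure.tendsto_iff_forall_lintegral_tendsto.1 (hP.tendsto z)) (hG.apprSeq n)

variable {Z K Y : Type*} [TopologicalSpace Z] [MeasurableSpace Z]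
  [MetricSpace K] [CompactSpace K] [MeasurableSpace K] [BorelSpace K]
  [MetricSpace Y] [CompactSpace Y] [MeasurableSpace Y] [BorelSpace Y]

/-- The probabilities on a compact space form a compact space, so cluster points exist along D at
each x₀; near-constancy makes them unique. Hence limits exist, and extension by density applies. -/
theorem exists_continuous_extension_compProd (lam : Measure K) [IsProbabilityMeasure lam]
    (η : Kernel (Z × K) Y) [IsMarkovKernel η] {D : Set Z} (hD : Dense D)
    (happ : ∀ ψ : K × Y → ℝ, Continuous ψ → ∀ (x₀ : Z) (ε : ℝ), 0 < ε →
      ∃ v : K → ℝ, Integrable v lam ∧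
        ∀ᶠ x in 𝓝[D] x₀, ∫ t, |∫ V, ψ (t, V) ∂(η (x, t)) - v t| ∂lam ≤ ε) :
    ∃ E : Z → ProbabilityMeasure (K × Y), Continuous E ∧
      ∀ x ∈ D, (E x : Measure (K × Y)) = lam ⊗ₘ η.sectR x := by
  have hmarkov : ∀ x, IsMarkovKernel (η.sectR x) := fun x => inferInstance
  set P : D → ProbabilityMeasure (K × Y) := fun x => ⟨lam ⊗ₘ η.sectR x, inferInstance⟩ with hP
  have hint : ∀ (ψ : BoundedContinuousFunction (K × Y) ℝ) (x : D),
      Integrable (fun t => ∫ V, ψ (t, V) ∂(η (x, t))) lam := fun ψ x =>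
    MeasureTheory.Integrable.integral_compProd (κ := Kernel.const Unit lam)
      (η := Kernel.prodMkLeft Unit (η.sectR x)) (a := ()) (f := ψ)
      (ψ.integrable (lam ⊗ₘ η.sectR x))
  have hPi : ∀ (ψ : BoundedContinuousFunction (K × Y) ℝ) (x : D),
      ∫ z, ψ z ∂(P x : Measure (K × Y)) = ∫ t, ∫ V, ψ (t, V) ∂(η (x, t)) ∂lam := fun ψ x =>
    Measure.integral_compProd (μ := lam) (κ := η.sectR x) (f := ψ) (ψ.integrable _)
  have hlim : ∀ x₀ : Z, ∃ c, Tendsto P (comap (Subtype.val : D → Z) (𝓝 x₀)) (𝓝 c) := by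
    intro x₀
    have hne : (comap (Subtype.val : D → Z) (𝓝 x₀)).NeBot :=
      mem_closure_iff_comap_neBot.1 (hD x₀)
    obtain ⟨c, hc⟩ := exists_clusterPt_of_compactSpace (map P (comap (Subtype.val : D → Z) (𝓝 x₀)))
    refine ⟨c, le_nhds_of_unique_clusterPt fun c' hc' => ?_⟩
    -- Every cluster point integrates ψ to within ε of the same number, the integral of v.
    have hclose : ∀ (ψ : BoundedContinuousFunction (K × Y) ℝ) (ε : ℝ), 0 < ε →
        ∃ r : ℝ, ∀ b, ClusterPt b (map P (comap (Subtype.val : D → Z) (𝓝 x₀))) →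
          |∫ z, ψ z ∂(b : Measure (K × Y)) - r| ≤ ε := by
      intro ψ ε hε
      obtain ⟨v, hv, hev⟩ := happ ψ ψ.continuous x₀ ε hε
      refine ⟨∫ t, v t ∂lam, fun b hb => ?_⟩
      have hcont : Continuous fun b : ProbabilityMeasure (K × Y) =>
          ∫ z, ψ z ∂(b : Measure (K × Y)) :=
        continuous_iff_continuousAt.2 fun b =>
          (ProbabilityMeasure.tendsto_iff_forall_integral_tendsto.1 tendsto_id) ψ
      have hclosed : IsClosed {b : ProbabilityMeasure (K × Y) |
          |∫ z, ψ z ∂(b : Measure (K × Y)) - ∫ t, v t ∂lam| ≤ ε} :=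
        isClosed_le (hcont.sub continuous_const).abs continuous_const
      have hmem : {b : ProbabilityMeasure (K × Y) |
          |∫ z, ψ z ∂(b : Measure (K × Y)) - ∫ t, v t ∂lam| ≤ ε} ∈
            map P (comap (Subtype.val : D → Z) (𝓝 x₀)) := by
        rw [mem_map]
        have h2 : ∀ᶠ x in 𝓝 x₀, x ∈ D → ∫ t, |∫ V, ψ (t, V) ∂(η (x, t)) - v t| ∂lam ≤ ε :=
          eventually_nhdsWithin_iff.1 hev
        refine (h2.comap Subtype.val).mono fun x hx => ?_
        show |∫ z, ψ z ∂(P x : Measure (K × Y)) - ∫ t, v t ∂lam| ≤ ε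
        rw [hPi, ← integral_sub (hint ψ x) hv]
        exact abs_integral_le_integral_abs.trans (hx x.2)
      have := clusterPt_iff_forall_mem_closure.1 hb _ hmem
      rwa [hclosed.closure_eq] at this
    apply Subtype.ext
    show (c' : Measure (K × Y)) = (c : Measure (K × Y))
    refine ext_of_forall_integral_eq_of_IsFiniteMeasure fun ψ => ?_
    refine eq_of_forall_dist_le fun ε hε => ?_
    obtain ⟨r, hr⟩ := hclose ψ (ε / 2) (by positivity)
    calc dist (∫ z, ψ z ∂(c' : Measure (K × Y))) (∫ z, ψ z ∂(c : Measure (K × Y)))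
        ≤ dist (∫ z, ψ z ∂(c' : Measure (K × Y))) r + dist (∫ z, ψ z ∂(c : Measure (K × Y))) r :=
          dist_triangle_right _ _ _
      _ ≤ ε / 2 + ε / 2 := add_le_add (hr c' hc') (hr c hc)
      _ = ε := add_halves ε
  have hind := hD.isDenseInducing_val
  refine ⟨hind.extend P, hind.continuous_extend hlim, fun x hx => ?_⟩
  have hcx : ContinuousAt P ⟨x, hx⟩ := by
    obtain ⟨c, hc⟩ := hlim x
    rw [← nhds_induced (Subtype.val : D → Z) ⟨x, hx⟩] at hc
    exact continuousAt_of_tendsto_nhds hc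
  have := hind.extend_eq_at hcx
  rw [this]
  rfl

/-- A kernel whose disintegrated integrals are nearly constant in `L¹` along a dense set of base
points can be modified off this set so as to become `L¹`-continuous. -/
theorem exists_continuous_modification [OpensMeasurableSpace Z] [Nonempty Y] (lam : Measure K) [IsProbabilityMeasure lam]
    (η : Kernel (Z × K) Y) [IsMarkovKernel η] {D : Set Z} (hD : Dense D)
    (happ : ∀ ψ : K × Y → ℝ, Continuous ψ → ∀ (x₀ : Z) (ε : ℝ), 0 < ε →
      ∃ v : K → ℝ, Integrable v lam ∧
        ∀ᶠ x in 𝓝[D] x₀, ∫ t, |∫ V, ψ (t, V) ∂(η (x, t)) - v t| ∂lam ≤ ε) :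
    ∃ m : Kernel (Z × K) Y, IsMarkovKernel m ∧ (∀ x ∈ D, ∀ᵐ t ∂lam, m (x, t) = η (x, t)) ∧
      ∀ φ : Y → ℝ, Continuous φ → ∀ x₀ : Z,
        Tendsto (fun x => ∫ t, |∫ V, φ V ∂(m (x, t)) - ∫ V, φ V ∂(m (x₀, t))| ∂lam)
          (𝓝 x₀) (𝓝 0) := by
  obtain ⟨E, hE, hED⟩ := exists_continuous_extension_compProd lam η hD happ
  have hcont : ∀ ψ : BoundedContinuousFunction (K × Y) ℝ,
      Continuous fun x => ∫ z, ψ z ∂(E x : Measure (K × Y)) := fun ψ =>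
    continuous_iff_continuousAt.2 fun x =>
      (ProbabilityMeasure.tendsto_iff_forall_integral_tendsto.1 (hE.tendsto x)) ψ
  let M : Kernel Z (K × Y) := ⟨fun x => (E x : Measure (K × Y)),
    measurable_of_continuous_probabilityMeasure hE⟩
  have hMx : ∀ x, M x = (E x : Measure (K × Y)) := fun x => rfl
  have : IsMarkovKernel M := ⟨fun x => (E x).2⟩
  -- Integrals of functions of t alone are constant on D, hence everywhere by continuity.
  have hfst : M.fst = Kernel.const Z lam := by
    ext1 x
    rw [Kernel.fst_apply, Kernel.const_apply, hMx]
    have : IsProbabilityMeasure ((E x : Measure (K × Y)).map Prod.fst) :=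
      Measure.isProbabilityMeasure_map measurable_fst.aemeasurable
    refine ext_of_forall_integral_eq_of_IsFiniteMeasure fun g => ?_
    rw [integral_map measurable_fst.aemeasurable g.continuous.measurable.aestronglyMeasurable]
    have h := (hcont (g.compContinuous ⟨Prod.fst, continuous_fst⟩)).ext_on hD continuous_const
      (g := fun _ => ∫ t, g t ∂lam) fun y hy => ?_
    · exact congrFun h x
    · simp only [BoundedContinuousFunction.compContinuous_apply, ContinuousMap.coe_mk]
      rw [← integral_map (f := fun t => g t) measurable_fst.aemeasurable
        g.continuous.measurable.aestronglyMeasurable, hED y hy]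
      have : (lam ⊗ₘ η.sectR y).map Prod.fst = lam := Measure.fst_compProd lam (η.sectR y)
      rw [this]
  -- The conditional kernel disintegrates all the E x at once, measurably in (x, t).
  have hdis : ∀ x, (E x : Measure (K × Y)) = lam ⊗ₘ M.condKernel.sectR x := fun x => by
    have h := congrArg (fun κ : Kernel Z (K × Y) => κ x) (M.disintegrate M.condKernel)
    simp only [hfst, Kernel.compProd_apply_eq_compProd_sectR, Kernel.const_apply] at h
    exact h.symm
  have hae : ∀ x ∈ D, ∀ᵐ t ∂lam, M.condKernel (x, t) = η (x, t) := fun x hx =>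
    Kernel.ae_eq_of_compProd_eq ((hdis x).symm.trans (hED x hx))
  refine ⟨M.condKernel, inferInstance, hae, fun φ hφ x₀ => ?_⟩
  obtain ⟨c, hc⟩ : ∃ c, ∀ V, |φ V| ≤ c := by
    obtain ⟨c, hc⟩ := isCompact_univ.exists_bound_of_continuousOn hφ.continuousOn
    exact ⟨c, fun V => hc V trivial⟩
  set u : Z → K → ℝ := fun x t => ∫ V, φ V ∂(M.condKernel (x, t)) with hu
  have huc : ∀ x t, |u x t| ≤ c := fun x t => abs_integral_le_of_forall hc
  have hum : ∀ x, Measurable (u x) := fun x =>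
    ((hφ.stronglyMeasurable.comp_measurable measurable_snd).integral_kernel_prod_right'
      (κ := M.condKernel.sectR x)).measurable
  have hui : ∀ x, Integrable (u x) lam := fun x =>
    Integrable.of_bound (hum x).aestronglyMeasurable c (ae_of_all _ (huc x))
  have hsub : ∀ x y t, |u x t - u y t| ≤ c + c := fun x y t =>
    (abs_sub _ _).trans (add_le_add (huc x t) (huc y t))
  have hdi : ∀ x y, Integrable (fun t => |u x t - u y t|) lam := fun x y =>
    ((hui x).sub (hui y)).abs
  have tri : ∀ x y z, ∫ t, |u x t - u z t| ∂lam ≤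
      ∫ t, |u x t - u y t| ∂lam + ∫ t, |u y t - u z t| ∂lam := fun x y z => by
    rw [← integral_add (hdi x y) (hdi y z)]
    exact integral_mono (hdi x z) ((hdi x y).add (hdi y z)) fun t => abs_sub_le _ _ _
  have hsymm : ∀ x y, ∫ t, |u x t - u y t| ∂lam = ∫ t, |u y t - u x t| ∂lam := fun x y => by
    simp only [abs_sub_comm]
  have hweak : ∀ a : K → ℝ, Continuous a → Continuous fun x => ∫ t, a t * u x t ∂lam := by
    intro a ha
    have hc' : Continuous fun z : K × Y => a z.1 * φ z.2 := by fun_prop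
    refine (hcont (BoundedContinuousFunction.mkOfCompact ⟨_, hc'⟩)).congr fun x => ?_
    simp only [BoundedContinuousFunction.mkOfCompact_apply, ContinuousMap.coe_mk]
    rw [hdis x, Measure.integral_compProd]
    · refine integral_congr_ae (ae_of_all _ fun t => ?_)
      simp only [integral_const_mul, Kernel.sectR_apply, hu]
    · exact (BoundedContinuousFunction.mkOfCompact ⟨_, hc'⟩).integrable _
  -- Two points x, y of D near z have u x and u y close in L¹. Pairing with a continuous a bounded
  -- by 1 and letting y tend to z by `hweak` replaces u y by u z, and the supremum over a restores
  -- the L¹ norm.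
  have hnearD : ∀ (z : Z) (ε : ℝ), 0 < ε →
      ∀ᶠ x in 𝓝[D] z, ∫ t, |u x t - u z t| ∂lam ≤ ε := by
    intro z ε hε
    obtain ⟨v, hv, hev⟩ := happ (fun p => φ p.2) (by fun_prop) z (ε / 2) (by positivity)
    have hev' : ∀ᶠ x in 𝓝[D] z, ∫ t, |u x t - v t| ∂lam ≤ ε / 2 := by
      filter_upwards [hev, self_mem_nhdsWithin] with x hx hxD
      refine le_trans (le_of_eq (integral_congr_ae ?_)) hx
      filter_upwards [hae x hxD] with t ht
      simp only [hu, ht]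
    have hne : (𝓝[D] z).NeBot := mem_closure_iff_nhdsWithin_neBot.1 (hD z)
    filter_upwards [hev'] with x hx
    refine integral_abs_le_of_forall_continuous ((hum x).sub (hum z)) (hsub x z) fun a ha ha1 => ?_
    have hai : ∀ y, Integrable (fun t => a t * u y t) lam := fun y =>
      (hui y).bdd_mul ha.measurable.aestronglyMeasurable (ae_of_all _ ha1)
    have hl : Tendsto (fun y => ∫ t, a t * u x t ∂lam - ∫ t, a t * u y t ∂lam) (𝓝[D] z)
        (𝓝 (∫ t, a t * u x t ∂lam - ∫ t, a t * u z t ∂lam)) :=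
      ((hweak a ha).tendsto z |>.mono_left nhdsWithin_le_nhds).const_sub _
    have e : ∀ y, ∫ t, a t * (u x t - u y t) ∂lam =
        ∫ t, a t * u x t ∂lam - ∫ t, a t * u y t ∂lam := fun y => by
      rw [← integral_sub (hai x) (hai y)]
      simp only [mul_sub]
    show ∫ t, a t * (u x t - u z t) ∂lam ≤ ε
    rw [e]
    refine le_of_tendsto hl ?_
    filter_upwards [hev'] with y hy
    have ix : Integrable (fun t => |u x t - v t|) lam := ((hui x).sub hv).abs
    have iy : Integrable (fun t => |u y t - v t|) lam := ((hui y).sub hv).abs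
    calc ∫ t, a t * u x t ∂lam - ∫ t, a t * u y t ∂lam
        = ∫ t, (a t * u x t - a t * u y t) ∂lam := (integral_sub (hai x) (hai y)).symm
      _ ≤ ∫ t, (|u x t - v t| + |u y t - v t|) ∂lam := by
          refine integral_mono ((hai x).sub (hai y)) (ix.add iy) fun t => ?_
          calc a t * u x t - a t * u y t = a t * (u x t - u y t) := by ring
            _ ≤ |a t| * |u x t - u y t| := by rw [← abs_mul]; exact le_abs_self _
            _ ≤ 1 * |u x t - u y t| := by gcongr; exact ha1 t
            _ ≤ |u x t - v t| + |u y t - v t| := by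
                rw [one_mul, abs_sub_comm (u y t)]; exact abs_sub_le _ _ _
      _ = ∫ t, |u x t - v t| ∂lam + ∫ t, |u y t - v t| ∂lam := integral_add ix iy
      _ ≤ ε / 2 + ε / 2 := add_le_add hx hy
      _ = ε := add_halves ε
  refine Metric.tendsto_nhds.2 fun ε hε => ?_
  obtain ⟨U, hU, hUo, hxU⟩ := eventually_nhds_iff.1
    (eventually_nhdsWithin_iff.1 (hnearD x₀ (ε / 3) (by positivity)))
  filter_upwards [hUo.mem_nhds hxU] with x hx
  have hne : (𝓝[D] x).NeBot := mem_closure_iff_nhdsWithin_neBot.1 (hD x)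
  -- As x need not lie in D, it is compared with x₀ through a point of D close to x and still inside
  -- U.
  obtain ⟨y, hy1, hy2, hy3⟩ := ((hnearD x (ε / 3) (by positivity)).and
    ((eventually_nhdsWithin_of_eventually_nhds (hUo.mem_nhds hx)).and self_mem_nhdsWithin)).exists
  rw [Real.dist_eq, sub_zero, abs_of_nonneg (integral_nonneg fun t => abs_nonneg _)]
  calc ∫ t, |u x t - u x₀ t| ∂lam
      ≤ ∫ t, |u x t - u y t| ∂lam + ∫ t, |u y t - u x₀ t| ∂lam := tri x y x₀
    _ ≤ ε / 3 + ε / 3 := add_le_add (by rw [hsymm]; exact hy1) (hU y hy2 hy3)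
    _ < ε := by linarith

end Extension

end UStates

/-! ### Composition with iterates and almost everywhere convergence -/

namespace UStates

open scoped NNReal ENNReal

theorem integral_comp_le_of_map_le {K : Type*} [MeasurableSpace K] {lam : Measure K} {C : ℝ≥0}
    {p : K → K} (hp : Measurable p) (hle : lam.map p ≤ C • lam) {h : K → ℝ} (hm : Measurable h)
    (hi : Integrable h lam) (h0 : ∀ t, 0 ≤ h t) : ∫ t, h (p t) ∂lam ≤ C * ∫ t, h t ∂lam := by
  rw [← integral_map (f := h) hp.aemeasurable hm.aestronglyMeasurable]
  exact (integral_mono_measure hle (ae_of_all _ h0) hi.smul_measure_nnreal).trans_eq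
    (integral_smul_nnreal_measure _ _)

/-- Replacing u₀ by a continuous w reduces the claim to pointwise convergence of w ∘ p k to w ∘ g.
The replacements cost a factor C, both along p k and along g, which inherits the Jacobian bound as a
limit. -/
theorem tendsto_integral_abs_comp_sub {K ι : Type*} [MetricSpace K] [MeasurableSpace K]
    [BorelSpace K] {L : Filter ι} [L.NeBot] [L.IsCountablyGenerated] {lam : Measure K}
    [IsFiniteMeasure lam] {C : ℝ≥0} {u : ι → K → ℝ} {u₀ : K → ℝ} {c : ℝ}
    (hu : ∀ k, Measurable (u k)) (hu₀ : Measurable u₀) (huc : ∀ k t, |u k t| ≤ c)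
    (huc₀ : ∀ t, |u₀ t| ≤ c) (hlim : Tendsto (fun k => ∫ t, |u k t - u₀ t| ∂lam) L (𝓝 0))
    {p : ι → K → K} {g : K → K} (hp : ∀ k, Measurable (p k)) (hle : ∀ k, lam.map (p k) ≤ C • lam)
    (hpg : ∀ t, Tendsto (fun k => p k t) L (𝓝 (g t))) :
    Tendsto (fun k => ∫ t, |u k (p k t) - u₀ (g t)| ∂lam) L (𝓝 0) := by
  have hg : Measurable g := measurable_of_tendsto_metrizable' L hp (tendsto_pi_nhds.2 hpg)
  have hgle : lam.map g ≤ C • lam := map_le_smul_of_tendsto hp hle hpg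
  have bdi : ∀ {h : K → ℝ} {M : ℝ}, Measurable h → (∀ t, |h t| ≤ M) → Integrable h lam :=
    fun hm hM => Integrable.of_bound hm.aestronglyMeasurable _ (ae_of_all _ hM)
  refine Metric.tendsto_nhds.2 fun ε hε => ?_
  obtain ⟨w, hw, hwi⟩ := (bdi hu₀ huc₀).exists_boundedContinuous_integral_sub_le
    (show 0 < ε / (8 * (C + 1)) by positivity)
  simp only [Real.norm_eq_abs] at hw
  have hwm : Measurable w := w.continuous.measurable
  have hwb : ∀ t, |w t| ≤ ‖w‖ := w.norm_coe_le_norm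
  have hwlim : Tendsto (fun k => ∫ t, |w (p k t) - w (g t)| ∂lam) L (𝓝 0) := by
    have h := tendsto_integral_filter_of_dominated_convergence (μ := lam) (l := L)
      (F := fun k t => |w (p k t) - w (g t)|) (f := fun _ => 0) (fun _ => ‖w‖ + ‖w‖)
      (Eventually.of_forall fun k =>
        ((hwm.comp (hp k)).sub (hwm.comp hg)).abs.aestronglyMeasurable)
      (Eventually.of_forall fun k => ae_of_all _ fun t => ?_) (integrable_const _)
      (ae_of_all _ fun t => ?_)
    · simpa using h
    · rw [Real.norm_eq_abs, abs_abs]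
      exact (abs_sub _ _).trans (add_le_add (hwb _) (hwb _))
    · simpa using (((w.continuous.tendsto _).comp (hpg t)).sub_const (w (g t))).abs
  filter_upwards [hlim.eventually (gt_mem_nhds (show 0 < ε / (4 * (C + 1)) by positivity)),
    hwlim.eventually (gt_mem_nhds (show 0 < ε / 4 by positivity))] with k hk1 hk2
  have d1m : Measurable fun t => |u k t - u₀ t| := ((hu k).sub hu₀).abs
  have d1i : Integrable (fun t => |u k t - u₀ t|) lam :=
    ((bdi (hu k) (huc k)).sub (bdi hu₀ huc₀)).abs
  have d2m : Measurable fun t => |u₀ t - w t| := (hu₀.sub hwm).abs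
  have d2i : Integrable (fun t => |u₀ t - w t|) lam := ((bdi hu₀ huc₀).sub hwi).abs
  have b1 := integral_comp_le_of_map_le (hp k) (hle k) d1m d1i fun t => abs_nonneg _
  have b2 := integral_comp_le_of_map_le (hp k) (hle k) d2m d2i fun t => abs_nonneg _
  have b3 := integral_comp_le_of_map_le hg hgle d2m d2i fun t => abs_nonneg _
  have iu : Integrable (fun t => u k (p k t)) lam := bdi ((hu k).comp (hp k)) fun t => huc k _
  have iv : Integrable (fun t => u₀ (p k t)) lam := bdi (hu₀.comp (hp k)) fun t => huc₀ _
  have iw : Integrable (fun t => w (p k t)) lam := bdi (hwm.comp (hp k)) fun t => hwb _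
  have iwg : Integrable (fun t => w (g t)) lam := bdi (hwm.comp hg) fun t => hwb _
  have iug : Integrable (fun t => u₀ (g t)) lam := bdi (hu₀.comp hg) fun t => huc₀ _
  have i1 : Integrable (fun t => |u k (p k t) - u₀ (p k t)|) lam := (iu.sub iv).abs
  have i2 : Integrable (fun t => |u₀ (p k t) - w (p k t)|) lam := (iv.sub iw).abs
  have i3 : Integrable (fun t => |w (p k t) - w (g t)|) lam := (iw.sub iwg).abs
  have i4 : Integrable (fun t => |u₀ (g t) - w (g t)|) lam := (iug.sub iwg).abs
  have i12 : Integrable (fun t => |u k (p k t) - u₀ (p k t)| + |u₀ (p k t) - w (p k t)|) lam :=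
    i1.add i2
  have i34 : Integrable (fun t => |w (p k t) - w (g t)| + |u₀ (g t) - w (g t)|) lam := i3.add i4
  rw [Real.dist_eq, sub_zero, abs_of_nonneg (integral_nonneg fun t => abs_nonneg _)]
  have hC : (0 : ℝ) < C + 1 := by positivity
  have e1 : (C : ℝ) * ∫ t, |u k t - u₀ t| ∂lam ≤ ε / 4 := by
    calc (C : ℝ) * ∫ t, |u k t - u₀ t| ∂lam ≤ (C + 1) * (ε / (4 * (C + 1))) := by
          gcongr
          linarith
      _ = ε / 4 := by field_simp
  have e2 : (C : ℝ) * ∫ t, |u₀ t - w t| ∂lam ≤ ε / 8 := by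
    calc (C : ℝ) * ∫ t, |u₀ t - w t| ∂lam ≤ (C + 1) * (ε / (8 * (C + 1))) := by
          gcongr
          linarith
      _ = ε / 8 := by field_simp
  calc ∫ t, |u k (p k t) - u₀ (g t)| ∂lam
      ≤ ∫ t, ((|u k (p k t) - u₀ (p k t)| + |u₀ (p k t) - w (p k t)|) +
          (|w (p k t) - w (g t)| + |u₀ (g t) - w (g t)|)) ∂lam := by
        refine integral_mono (iu.sub iug).abs (i12.add i34) fun t => ?_
        refine (abs_sub_le _ (w (p k t)) _).trans (add_le_add (abs_sub_le _ _ _) ?_)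
        rw [abs_sub_comm (u₀ (g t))]
        exact abs_sub_le _ _ _
    _ = ∫ t, |u k (p k t) - u₀ (p k t)| ∂lam + ∫ t, |u₀ (p k t) - w (p k t)| ∂lam +
          (∫ t, |w (p k t) - w (g t)| ∂lam + ∫ t, |u₀ (g t) - w (g t)| ∂lam) := by
        rw [integral_add i12 i34, integral_add i1 i2, integral_add i3 i4]
    _ < ε := by linarith

/-- The L¹ errors are summable, so the series of pointwise errors is finite almost everywhere and
its terms tend to zero. -/
theorem ae_tendsto_of_integral_abs_le {K : Type*} [MeasurableSpace K] {lam : Measure K}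
    {v : ℕ → K → ℝ} {v₀ : K → ℝ} (hv : ∀ k, Integrable (v k) lam) (hv₀ : Integrable v₀ lam)
    (h : ∀ k, ∫ t, |v k t - v₀ t| ∂lam ≤ (1 / 2) ^ k) :
    ∀ᵐ t ∂lam, Tendsto (fun k => v k t) atTop (𝓝 (v₀ t)) := by
  have hm : ∀ k, AEMeasurable (fun t => ENNReal.ofReal |v k t - v₀ t|) lam := fun k =>
    ((hv k).sub hv₀).abs.aestronglyMeasurable.aemeasurable.ennreal_ofReal
  have hfin : ∫⁻ t, ∑' k, ENNReal.ofReal |v k t - v₀ t| ∂lam ≠ ⊤ := by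
    rw [lintegral_tsum hm]
    have hle : ∀ k, ∫⁻ t, ENNReal.ofReal |v k t - v₀ t| ∂lam ≤ ENNReal.ofReal ((1 / 2) ^ k) :=
      fun k => by
        have hk : Integrable (fun t => |v k t - v₀ t|) lam := ((hv k).sub hv₀).abs
        rw [← ofReal_integral_eq_lintegral_ofReal hk
          (ae_of_all _ fun t => abs_nonneg _)]
        exact ENNReal.ofReal_le_ofReal (h k)
    refine ne_top_of_le_ne_top ?_ (ENNReal.tsum_le_tsum hle)
    rw [← ENNReal.ofReal_tsum_of_nonneg (fun k => by positivity) summable_geometric_two]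
    exact ENNReal.ofReal_ne_top
  filter_upwards [ae_lt_top' (AEMeasurable.tsum hm) hfin] with t ht
  have h0 := ENNReal.tendsto_atTop_zero_of_tsum_ne_top ht.ne
  have h1 := (ENNReal.tendsto_toReal ENNReal.zero_ne_top).comp h0
  refine tendsto_iff_dist_tendsto_zero.2 ?_
  refine h1.congr fun k => ?_
  simp only [Function.comp_apply, Real.dist_eq]
  rw [ENNReal.toReal_ofReal (abs_nonneg _)]

/-- `L¹`-convergence of all integrals yields almost everywhere weak* convergence along a
subsequence. -/
theorem exists_subseq_ae_tendsto {K Y : Type*} [MeasurableSpace K] [MetricSpace Y] [CompactSpace Y]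
    [MeasurableSpace Y] [BorelSpace Y] {lam : Measure K} [IsFiniteMeasure lam]
    (κ : ℕ → Kernel K Y) [∀ k, IsMarkovKernel (κ k)] (κ₀ : Kernel K Y) [IsMarkovKernel κ₀]
    (h : ∀ φ : Y → ℝ, Continuous φ →
      Tendsto (fun k => ∫ t, |∫ V, φ V ∂(κ k t) - ∫ V, φ V ∂(κ₀ t)| ∂lam) atTop (𝓝 0)) :
    ∃ i : ℕ → ℕ, StrictMono i ∧ ∀ᵐ t ∂lam, ∀ φ : Y → ℝ, Continuous φ →
      Tendsto (fun k => ∫ V, φ V ∂(κ (i k) t)) atTop (𝓝 (∫ V, φ V ∂(κ₀ t))) := by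
  let θ : ℕ → C(Y, ℝ) := TopologicalSpace.denseSeq C(Y, ℝ)
  have hθ : DenseRange θ := TopologicalSpace.denseRange_denseSeq _
  have hbd : ∀ (φ : C(Y, ℝ)) V, |φ V| ≤ ‖φ‖ := fun φ V => φ.norm_coe_le_norm V
  have hint : ∀ (η : Kernel K Y) [IsMarkovKernel η] (φ : C(Y, ℝ)),
      Integrable (fun t => ∫ V, φ V ∂(η t)) lam := fun η _ φ =>
    Integrable.of_bound ((φ.continuous.stronglyMeasurable.comp_measurable
      measurable_snd).integral_kernel_prod_right' (κ := η)).aestronglyMeasurable ‖φ‖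
      (ae_of_all _ fun t => abs_integral_le_of_forall (hbd φ))
  -- Diagonal choice: the k-th index serves the first k + 1 functions of the dense sequence.
  -- Function a is thus controlled only from k = a on, whence the shift by a below.
  obtain ⟨i, hi, hle⟩ := extraction_forall_of_eventually'
    (P := fun k n => ∀ a ∈ Finset.range (k + 1),
      ∫ t, |∫ V, θ a V ∂(κ n t) - ∫ V, θ a V ∂(κ₀ t)| ∂lam ≤ (1 / 2) ^ k)
    fun k => eventually_atTop.1 ((Finset.eventually_all _).2 fun a _ =>
      (h (θ a) (θ a).continuous).eventually (ge_mem_nhds (by positivity)))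
  refine ⟨i, hi, ?_⟩
  have hae : ∀ a, ∀ᵐ t ∂lam,
      Tendsto (fun k => ∫ V, θ a V ∂(κ (i k) t)) atTop (𝓝 (∫ V, θ a V ∂(κ₀ t))) := by
    intro a
    have h1 := ae_tendsto_of_integral_abs_le (lam := lam)
      (v := fun k t => ∫ V, θ a V ∂(κ (i (k + a)) t)) (v₀ := fun t => ∫ V, θ a V ∂(κ₀ t))
      (fun k => hint _ (θ a)) (hint _ (θ a)) fun k =>
        (hle (k + a) a (Finset.mem_range.2 (by omega))).trans
          (pow_le_pow_of_le_one (by norm_num) (by norm_num) (by omega))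
    filter_upwards [h1] with t ht
    exact (tendsto_add_atTop_iff_nat a).1 ht
  filter_upwards [ae_all_iff.2 hae] with t ht φ hφ
  have happrox : ∀ (ν : Measure Y) [IsProbabilityMeasure ν] (a : ℕ),
      |∫ V, φ V ∂ν - ∫ V, θ a V ∂ν| ≤ dist (⟨φ, hφ⟩ : C(Y, ℝ)) (θ a) := by
    intro ν _ a
    have hi : ∀ f : C(Y, ℝ), Integrable f ν := fun f =>
      Integrable.of_bound f.continuous.measurable.aestronglyMeasurable ‖f‖ (ae_of_all _ (hbd f))
    have hiφ : Integrable φ ν := hi ⟨φ, hφ⟩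
    rw [← integral_sub hiφ (hi (θ a))]
    exact abs_integral_le_of_forall fun V =>
      ContinuousMap.dist_apply_le_dist (f := (⟨φ, hφ⟩ : C(Y, ℝ))) (g := θ a) V
  refine Metric.tendsto_nhds.2 fun ε hε => ?_
  obtain ⟨a, ha⟩ := hθ.exists_dist_lt (⟨φ, hφ⟩ : C(Y, ℝ)) (show 0 < ε / 3 by positivity)
  filter_upwards [Metric.tendsto_nhds.1 (ht a) (ε / 3) (by positivity)] with k hk
  have b1 := happrox (κ (i k) t) a
  have b2 := happrox (κ₀ t) a
  rw [Real.dist_eq] at hk ⊢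
  calc |∫ V, φ V ∂(κ (i k) t) - ∫ V, φ V ∂(κ₀ t)|
      ≤ |∫ V, φ V ∂(κ (i k) t) - ∫ V, θ a V ∂(κ (i k) t)| +
        |∫ V, θ a V ∂(κ (i k) t) - ∫ V, φ V ∂(κ₀ t)| := abs_sub_le _ _ _
    _ ≤ |∫ V, φ V ∂(κ (i k) t) - ∫ V, θ a V ∂(κ (i k) t)| +
        (|∫ V, θ a V ∂(κ (i k) t) - ∫ V, θ a V ∂(κ₀ t)| +
          |∫ V, θ a V ∂(κ₀ t) - ∫ V, φ V ∂(κ₀ t)|) := by gcongr; exact abs_sub_le _ _ _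
    _ < ε := by rw [abs_sub_comm (∫ V, θ a V ∂(κ₀ t))]; linarith

theorem compProd_prod_congr {Z K Y : Type*} [MeasurableSpace Z] [MeasurableSpace K]
    [MeasurableSpace Y] {μ : Measure Z} {lam : Measure K} [SFinite μ] [SFinite lam]
    {κ η : Kernel (Z × K) Y} [IsSFiniteKernel κ] [IsSFiniteKernel η]
    (h : ∀ᵐ x ∂μ, ∀ᵐ t ∂lam, κ (x, t) = η (x, t)) : (μ.prod lam) ⊗ₘ κ = (μ.prod lam) ⊗ₘ η := by
  ext s hs
  rw [Measure.compProd_apply hs, Measure.compProd_apply hs,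
    lintegral_prod _ (Kernel.measurable_kernel_prodMk_left hs).aemeasurable,
    lintegral_prod _ (Kernel.measurable_kernel_prodMk_left hs).aemeasurable]
  refine lintegral_congr_ae ?_
  filter_upwards [h] with x hx
  refine lintegral_congr_ae ?_
  filter_upwards [hx] with t ht
  rw [ht]

end UStates

/-! ### The proposition -/

theorem propositionp {X : Set ℕ} (hX : X.Nontrivial) {n : ℕ} {K : Type*}
    [MetricSpace K] [CompactSpace K] [MeasurableSpace K] [BorelSpace K]
    [ChartedSpace (EuclideanSpace ℝ (Fin n)) K] [IsManifold (𝓡 n) ∞ K]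
    [RiemannianBundle (fun t : K => TangentSpace (𝓡 n) t)]
    [IsContMDiffRiemannianBundle (𝓡 n) ∞ (EuclideanSpace ℝ (Fin n))
      (fun t : K => TangentSpace (𝓡 n) t)]
    [IsRiemannianManifold (𝓡 n) K]
    -- the skew-product and its invariant measure
    (F : UStates.SkewProduct X n K) (hF : F.MostlyNeutral)
    (μ : UStates.PartialProduct X K) (hμ : MeasurePreserving F.map μ.measure μ.measure)
    -- the linear cocycle and its strong-unstable holonomies
    {l d : ℕ} (hl : 1 ≤ l) (hld : l < d) {α : ℝ} (hα : 0 < α)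
    (A : (ℤ → X) × K → (EuclideanSpace ℂ (Fin d) ≃L[ℂ] EuclideanSpace ℂ (Fin d)))
    (hA : UStates.IsHolderCocycle α A)
    (H : (ℤ → X) × K → (ℤ → X) × K →
      (EuclideanSpace ℂ (Fin d) ≃L[ℂ] EuclideanSpace ℂ (Fin d)))
    (hH : UStates.IsUnstableHolonomy F α A H)
    -- the fibre maps and the cocycle depend on the future only
    (f : (ℕ → X) → K → K) (hf : ∀ x t, F.fib x t = f (UStates.future x) t)
    (hAf : ∀ x y t, UStates.future x = UStates.future y → A (x, t) = A (y, t))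
    -- an invariant `u`-state
    (mhat : Measure (((ℤ → X) × K) × UStates.Grass l d))
    (hinv : MeasurePreserving (UStates.grassMap F A) mhat mhat)
    (κ : Kernel ((ℤ → X) × K) (UStates.Grass l d)) (S : Set ((ℤ → X) × K))
    (hm : UStates.IsUState F H μ.measure mhat κ S) :
    ∃ m : Kernel ((ℕ → X) × K) (UStates.Grass l d),
      -- `m` is a disintegration of the projection of `mhat`
      IsMarkovKernel m ∧
      (μ.measure.map (fun p => (UStates.future p.1, p.2))) ⊗ₘ m =
        mhat.map (fun z => ((UStates.future z.1.1, z.1.2), z.2)) ∧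
      -- it is the average of `κ` along the pasts, for each future with `S` of full measure above it
      (∀ x : ℕ → X, (∀ᵐ p ∂(μ.μs.prod μ.μc), (UStates.glue p.1 x, p.2) ∈ S) →
        ∀ᵐ t ∂μ.μc, m (x, t) =
          (ENNReal.ofReal (μ.ρu x t))⁻¹ •
            (μ.μs.withDensity (fun xs => ENNReal.ofReal (μ.ρ (UStates.glue xs x, t)))).bind
              (fun xs => κ (UStates.glue xs x, t))) ∧
      -- `L¹` continuity
      (∀ (φ : UStates.Grass l d → ℝ), Continuous φ →
        ∀ (x : ℕ → ℕ → X) (x₀ : ℕ → X), Tendsto x atTop (𝓝 x₀) →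
        ∀ (j : ℕ → ℕ) (g : K → K),
          TendstoUniformly (fun k => UStates.oneSidedIter f (x k) (j k)) g atTop →
          (∀ k, MemLp (fun t => ∫ V, φ V ∂(m (x k, UStates.oneSidedIter f (x k) (j k) t)))
            1 μ.μc) ∧
          MemLp (fun t => ∫ V, φ V ∂(m (x₀, g t))) 1 μ.μc ∧
          Tendsto (fun k => eLpNorm
            (fun t => ∫ V, φ V ∂(m (x k, UStates.oneSidedIter f (x k) (j k) t)) -
              ∫ V, φ V ∂(m (x₀, g t))) 1 μ.μc) atTop (𝓝 0)) ∧
      -- almost everywhere weak* convergence along a subsequence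
      (∀ (x : ℕ → ℕ → X) (x₀ : ℕ → X), Tendsto x atTop (𝓝 x₀) →
        ∃ i : ℕ → ℕ, StrictMono i ∧ ∀ᵐ t ∂μ.μc,
          ∀ φ : UStates.Grass l d → ℝ, Continuous φ →
            Tendsto (fun k => ∫ V, φ V ∂(m (x (i k), t))) atTop
              (𝓝 (∫ V, φ V ∂(m (x₀, t))))) := by
  have : IsMarkovKernel κ := hm.markov
  have hdense := μ.dense_fullFutures hm.full
  have hY : Nonempty (UStates.Grass l d) := by
    obtain ⟨p⟩ := nonempty_of_isProbabilityMeasure μ.measure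
    exact nonempty_of_isProbabilityMeasure (κ p)
  obtain ⟨m, hmM, hmD, hmc⟩ := UStates.exists_continuous_modification μ.μc (μ.avgKernel κ) hdense
    fun ψ hψ x₀ ε hε => UStates.exists_integral_abs_avg_sub_le hF μ hμ hα hH hm.invariant hdense hψ x₀ hε
  obtain ⟨C, hC⟩ := μ.exists_map_fwd_le F hμ
  have hbd : ∀ φ : UStates.Grass l d → ℝ, Continuous φ → ∃ c, ∀ V, |φ V| ≤ c := fun φ hφ => by
    obtain ⟨c, hc⟩ := isCompact_univ.exists_bound_of_continuousOn hφ.continuousOn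
    exact ⟨c, fun V => hc V trivial⟩
  have humeas : ∀ φ : UStates.Grass l d → ℝ, Continuous φ → ∀ x,
      Measurable fun t => ∫ V, φ V ∂(m (x, t)) := fun φ hφ x =>
    ((hφ.stronglyMeasurable.comp_measurable measurable_snd).integral_kernel_prod_right'
      (κ := m.sectR x)).measurable
  refine ⟨m, hmM, ?_, fun x hx => hmD x hx, ?_, ?_⟩
  -- The kernels agree for almost every t over almost every x. Equality of the composition products
  -- turns this into agreement almost everywhere for the product measure.
  · have hae : m =ᵐ[μ.oneSided] μ.avgKernel κ :=
      μ.oneSided_absolutelyContinuous.ae_le (Kernel.ae_eq_of_compProd_eq (UStates.compProd_prod_congr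
        ((μ.ae_mem_fullFutures hm.full).mono fun x hx => hmD x hx)))
    have h := (Measure.compProd_congr hae).trans (μ.oneSided_compProd_avgKernel κ)
    rw [hm.disintegration] at h
    exact h
  · intro φ hφ x x₀ hx j g hg
    obtain ⟨c, hc⟩ := hbd φ hφ
    have hub : ∀ y t, |∫ V, φ V ∂(m (y, t))| ≤ c := fun y t => UStates.abs_integral_le_of_forall hc
    -- Any past would do; y itself is a convenient one.
    have hfwd : ∀ y i, UStates.oneSidedIter f y i = F.fwd (UStates.glue y y) i := fun y i =>
      funext fun t => F.oneSidedIter_eq_fwd hf (UStates.glue y y) i t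
    have hpc : ∀ k, Continuous (UStates.oneSidedIter f (x k) (j k)) := fun k => by
      rw [hfwd]; exact (F.fwd _ _).continuous
    have hgc : Continuous g := hg.continuous (Frequently.of_forall hpc)
    have hmeas : ∀ k, Measurable fun t =>
        ∫ V, φ V ∂(m (x k, UStates.oneSidedIter f (x k) (j k) t)) := fun k =>
      (humeas φ hφ (x k)).comp (hpc k).measurable
    have hmeas₀ : Measurable fun t => ∫ V, φ V ∂(m (x₀, g t)) :=
      (humeas φ hφ x₀).comp hgc.measurable
    have hLp : ∀ k, MemLp (fun t => ∫ V, φ V ∂(m (x k, UStates.oneSidedIter f (x k) (j k) t))) 1 μ.μc :=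
      fun k => MemLp.of_bound (hmeas k).aestronglyMeasurable c (ae_of_all _ fun t => hub _ _)
    have hLp₀ : MemLp (fun t => ∫ V, φ V ∂(m (x₀, g t))) 1 μ.μc :=
      MemLp.of_bound hmeas₀.aestronglyMeasurable c (ae_of_all _ fun t => hub _ _)
    refine ⟨hLp, hLp₀, ?_⟩
    have hlim := UStates.tendsto_integral_abs_comp_sub (lam := μ.μc) (C := C) (L := atTop)
      (u := fun k t => ∫ V, φ V ∂(m (x k, t))) (u₀ := fun t => ∫ V, φ V ∂(m (x₀, t)))
      (fun k => humeas φ hφ (x k)) (humeas φ hφ x₀) (fun k t => hub _ _) (fun t => hub _ _)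
      ((hmc φ hφ x₀).comp hx) (p := fun k => UStates.oneSidedIter f (x k) (j k)) (g := g)
      (fun k => (hpc k).measurable) (fun k => by rw [hfwd]; exact (hC _ _).1)
      fun t => hg.tendsto_at t
    have hlim' := (ENNReal.continuous_ofReal.tendsto 0).comp hlim
    rw [ENNReal.ofReal_zero] at hlim'
    refine hlim'.congr fun k => ?_
    have hi : Integrable (fun t => ∫ V, φ V ∂(m (x k, UStates.oneSidedIter f (x k) (j k) t)) -
        ∫ V, φ V ∂(m (x₀, g t))) μ.μc := memLp_one_iff_integrable.1 ((hLp k).sub hLp₀)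
    rw [eLpNorm_one_eq_lintegral_enorm, ← ofReal_integral_norm_eq_lintegral_enorm hi]
    rfl
  · intro x x₀ hx
    exact UStates.exists_subseq_ae_tendsto (lam := μ.μc) (fun k => m.sectR (x k)) (m.sectR x₀)
      fun φ hφ => (hmc φ hφ x₀).comp hx
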